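/- All rings are commutative with $1$, and rings are not assumed Noetherian; a local ring is a ring with a unique maximal ideal. An ideal is regular if it contains a nonzerodivisor. An ideal is stable if it is projective as a module over its ring of endomorphisms, and a ring is stable if each of its regular ideals is stable. A ring is a Dedekind ring if each of its regular ideals is invertible (zerodivisors are allowed). An extension of rings $R\subseteq S$ is quadratic if $xy\in xR+yR+R$ for all $x,y\in S$. Let $Q(R)$ denote the total ring of quotients of $R$ and $\operatorname{Jac} A$ the Jacobson radical of a ring $A$. Put $R_0=R$, $R_{i}=\{q\in Q(R): q\operatorname{Jac}R_{i-1}\subseteq \operatorname{Jac}R_{i-1}\}$ for $i\ge 1$, and $R_\infty=\bigcup_{i\ge 1}R_i$. The ring $R$ is a quadratic ring if $R$ is local, $R\subseteq R_\infty$ is a quadratic extension, and the maximal ideal of $R$ is stable and regular. Corollary 4.4. Let $R$ be a local ring of Krull dimension one whose maximal ideal is regular. Then $R$ is a quadratic ring if and only if either $R$ is a stable ring, or $R=k+\operatorname{Jac}S$, where $k$ is the prime subring of $R$ and $S$ is a Dedekind ring with $R\subseteq S\subseteq Q(R)$ that has exactly three maximal ideals, each with residue field isomorphic to $\mathbb{F}_2$.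 -/

import Mathlib

open scoped Pointwise

namespace OneDimStable

/-- A regular ideal: an ideal containing a nonzerodivisor. -/
def IsRegularIdeal {R : Type*} [CommRing R] (I : Ideal R) : Prop :=
  ∃ x ∈ I, x ∈ nonZeroDivisors R

/-- A stable ideal: an ideal that is projective as a module over its ring of endomorphisms
(the ring `End_R(I)` acting on `I` by evaluation). -/
def IsStableIdeal {R : Type*} [CommRing R] (I : Ideal R) : Prop :=
  Module.Projective (Module.End R I) I

/-- A stable ring: every regular ideal is stable. -/
def IsStableRing (R : Type*) [CommRing R] : Prop :=
  ∀ I : Ideal R, IsRegularIdeal I → IsStableIdeal I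

/-- A Dedekind ring, zerodivisors allowed: every regular ideal is invertible, that is, it is a unit
in the monoid of fractional ideals inside the total ring of quotients. -/
def IsDedekindWithZeroDivisors (A : Type*) [CommRing A] : Prop :=
  ∀ I : Ideal A, IsRegularIdeal I →
    IsUnit (I : FractionalIdeal (nonZeroDivisors A) (FractionRing A))

/-- A quadratic extension `R ⊆ S`: `x y ∈ x R + y R + R` for all `x, y ∈ S`. -/
def IsQuadraticExtension (R S : Type*) [CommRing R] [CommRing S] [Algebra R S] : Prop :=
  ∀ x y : S, x * y ∈ Submodule.span R ({x, y, 1} : Set S)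

section Tower

variable {R Q : Type*} [CommRing R] [CommRing Q] [Algebra R Q]

/-- The Jacobson radical of a ring `A` between `R` and `Q`, as a subset of `Q`. -/
def jac (A : Subalgebra R Q) : Submodule R Q :=
  ((Ideal.jacobson (⊥ : Ideal A)).restrictScalars R).map A.val.toLinearMap

/-- The ring `E(I) = {q ∈ Q : q I ⊆ I}`. -/
def endRing (I : Submodule R Q) : Subalgebra R Q where
  carrier := {q | ∀ x ∈ I, q * x ∈ I}
  mul_mem' := fun {a b} ha hb x hx => by
    rw [mul_assoc]
    exact ha _ (hb x hx)
  add_mem' := fun {a b} ha hb x hx => by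
    rw [add_mul]
    exact I.add_mem (ha x hx) (hb x hx)
  algebraMap_mem' := fun r x hx => by
    rw [← Algebra.smul_def]
    exact I.smul_mem r hx

variable (R Q)

/-- The tower `R_0 = R`, `R_{i+1} = E(Jac R_i)` of rings inside `Q`. -/
def tower : ℕ → Subalgebra R Q
  | 0 => ⊥
  | i + 1 => endRing (jac (tower i))

/-- The ring `R_∞`, the union of the increasing chain `R_0 ⊆ R_1 ⊆ R_2 ⊆ ⋯`. -/
def towerTop : Subalgebra R Q := ⨆ i, tower R Q i

end Tower

/-- A quadratic ring `R` with total ring of quotients `Q`: `R` is local, `R ⊆ R_∞` is a quadratic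
extension, and the maximal ideal of `R` is stable and regular. -/
structure IsQuadraticRing (R Q : Type*) [CommRing R] [CommRing Q] [Algebra R Q]
    [IsFractionRing R Q] : Prop where
  [isLocalRing : IsLocalRing R]
  isQuadraticExtension : IsQuadraticExtension R (towerTop R Q)
  isStableIdeal : IsStableIdeal (IsLocalRing.maximalIdeal R)
  isRegularIdeal : IsRegularIdeal (IsLocalRing.maximalIdeal R)

end OneDimStable

namespace OneDimStable

open IsLocalRing
open scoped nonZeroDivisors

/-! ### Quadratic algebras over a local ring: residues and radical -/

section QuadraticAlgebra

variable {R C : Type*} [CommRing R] [CommRing C] [Algebra R C]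

/-! Write `M` for the maximal ideal of `R` and `B` for `R_∞`. A quadratic extension is integral, and
testing its relations on elements with prescribed residues limits its maximal ideals: there are at
most three (`eq_or_eq_of_isMaximal`), and three force residue fields `𝔽₂` (`mem_or_sub_one_mem`).
Moreover `(Jac B)² ⊆ MB`, with `Jac B = MB` once `B` is not local (`jacobson_eq_of_ne`).

Let `R` be quadratic. Stability gives `M = m R₁` with `m` a unit of `Q` (`exists_generator`).
Climbing the tower, either some radical is generated by a unit of `Q` and the tower stops, or each
ring is local with `Jac Rₙ = m Rₙ₊₁`; in both cases `Jac B` is principal (`exists_jac_towerTop`). In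
dimension one this makes every regular ideal of `B` principal. If `B` has at most two maximal
ideals, a regular ideal `I` contains `i` with `IB = iB`, and the quadratic relation turns this into
`I² = iI`, so `I` is stable. If `B` has three, the tower stops at `R₁` (`towerTop_eq`), so `Jac B =
mR₁ = M`, and residue field `𝔽₂` gives `R = k + Jac B`.

Conversely, if `R` is stable, a finitely generated `I` with `1 ∈ I` inside some `Rₙ` is invertible
over `E(I)`; a Krull intersection argument shows that `I` is a ring (`IsStableRing.le_endRing`), and
`I = xR + yR + R` gives the quadratic relation. If `R = k + Jac S`, then `M = Jac S` is principal
over `S`, so `B = S`, and three residue fields `𝔽₂` make `xy` affine in `x`, `y` modulo `Jac S`. -/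

theorem IsQuadraticExtension.exists_mul_eq (hq : IsQuadraticExtension R C) (x y : C) :
    ∃ a b c : R, x * y =
      algebraMap R C a * x + algebraMap R C b * y + algebraMap R C c := by
  obtain ⟨a, b, c, h⟩ := Submodule.mem_span_triple.1 (hq x y)
  refine ⟨a, b, c, ?_⟩
  rw [← h]
  simp [Algebra.smul_def]

theorem IsQuadraticExtension.exists_sq_eq (hq : IsQuadraticExtension R C) (x : C) :
    ∃ a c : R, x * x = algebraMap R C a * x + algebraMap R C c := by
  obtain ⟨a, b, c, h⟩ := hq.exists_mul_eq x x
  refine ⟨a + b, c, ?_⟩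
  rw [h, map_add]
  ring

theorem IsQuadraticExtension.isIntegral (hq : IsQuadraticExtension R C) :
    Algebra.IsIntegral R C := by
  refine ⟨fun x => ?_⟩
  obtain ⟨a, c, h⟩ := hq.exists_sq_eq x
  refine ⟨Polynomial.X ^ 2 - (Polynomial.C a * Polynomial.X + Polynomial.C c), ?_, ?_⟩
  · exact Polynomial.monic_X_pow_sub (Polynomial.degree_linear_le.trans_lt (by norm_num))
  · simp [pow_two, h]

variable [IsLocalRing R]

theorem algebraMap_mem_iff_of_isIntegral [Algebra.IsIntegral R C] {P : Ideal C}
    (hP : P.IsMaximal) {r : R} :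
    algebraMap R C r ∈ P ↔ r ∈ maximalIdeal R := by
  have h := IsLocalRing.eq_maximalIdeal
    (Ideal.isMaximal_comap_of_isIntegral_of_isMaximal (R := R) P)
  rw [← h, Ideal.mem_comap]

theorem map_maximalIdeal_le_of_isMaximal [Algebra.IsIntegral R C] {P : Ideal C}
    (hP : P.IsMaximal) : (maximalIdeal R).map (algebraMap R C) ≤ P :=
  Ideal.map_le_iff_le_comap.2 fun _ hr => (algebraMap_mem_iff_of_isIntegral hP).2 hr

theorem map_maximalIdeal_le_jacobson [Algebra.IsIntegral R C] :
    (maximalIdeal R).map (algebraMap R C) ≤ Ideal.jacobson (⊥ : Ideal C) :=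
  le_sInf fun _ hP => map_maximalIdeal_le_of_isMaximal hP.2

theorem jacobson_bot_le_of_isMaximal {P : Ideal C} (hP : P.IsMaximal) :
    Ideal.jacobson (⊥ : Ideal C) ≤ P :=
  sInf_le ⟨bot_le, hP⟩

theorem exists_forall_sub_mem_of_isMaximal {ι : Type*} [Finite ι] {P : ι → Ideal C}
    (hP : ∀ i, (P i).IsMaximal) (hinj : Function.Injective P) (a : ι → C) :
    ∃ x, ∀ i, x - a i ∈ P i :=
  Ideal.exists_forall_sub_mem_ideal (fun i j hij =>
    have := hP i
    have := hP j
    Ideal.isCoprime_of_isMaximal (hinj.ne hij)) a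

theorem exists_congruences {P₁ P₂ P₃ : Ideal C} (h₁ : P₁.IsMaximal) (h₂ : P₂.IsMaximal)
    (h₃ : P₃.IsMaximal) (h₁₂ : P₁ ≠ P₂) (h₁₃ : P₁ ≠ P₃) (h₂₃ : P₂ ≠ P₃) (a b c : C) :
    ∃ x, x - a ∈ P₁ ∧ x - b ∈ P₂ ∧ x - c ∈ P₃ := by
  obtain ⟨x, hx⟩ := exists_forall_sub_mem_of_isMaximal (P := ![P₁, P₂, P₃])
    (by intro i; fin_cases i <;> simpa)
    (by
      intro i j
      fin_cases i <;> fin_cases j <;> simp [h₁₂, h₁₃, h₂₃, h₁₂.symm, h₁₃.symm, h₂₃.symm])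
    ![a, b, c]
  exact ⟨x, hx 0, hx 1, hx 2⟩

theorem exists_congruences_pair {P₁ P₂ : Ideal C} (h₁ : P₁.IsMaximal) (h₂ : P₂.IsMaximal)
    (h₁₂ : P₁ ≠ P₂) (a b : C) : ∃ x, x - a ∈ P₁ ∧ x - b ∈ P₂ := by
  obtain ⟨u, hu, v, hv, huv⟩ := Submodule.mem_sup.1
    ((Ideal.eq_top_iff_one _).1 (Ideal.IsMaximal.coprime_of_ne h₁ h₂ h₁₂))
  refine ⟨v * a + u * b, ?_, ?_⟩
  · have : v * a + u * b - a = u * (b - a) := by linear_combination a * huv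
    rw [this]
    exact P₁.mul_mem_right _ hu
  · have : v * a + u * b - b = v * (a - b) := by linear_combination b * huv
    rw [this]
    exact P₂.mul_mem_right _ hv

/-- With four maximal ideals, take `x` and `y` with residues `(1,1,0,0)` and `(1,0,1,0)`. In `xy =
ax + by + c` the last three places put `c`, `a`, `b` in the maximal ideal of `R`, and the first then
reads `1 = 0`. -/
theorem IsQuadraticExtension.eq_or_eq_of_isMaximal (hq : IsQuadraticExtension R C)
    {P₁ P₂ P₃ P₄ : Ideal C} (h₁ : P₁.IsMaximal) (h₂ : P₂.IsMaximal)
    (h₃ : P₃.IsMaximal) (h₄ : P₄.IsMaximal) (h₁₂ : P₁ ≠ P₂) (h₁₃ : P₁ ≠ P₃) (h₂₃ : P₂ ≠ P₃) :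
    P₄ = P₁ ∨ P₄ = P₂ ∨ P₄ = P₃ := by
  have := hq.isIntegral
  by_contra! hne
  obtain ⟨h₄₁, h₄₂, h₄₃⟩ := hne
  have hcrt := exists_forall_sub_mem_of_isMaximal (P := ![P₁, P₂, P₃, P₄])
    (by intro i; fin_cases i <;> simpa)
    (by
      intro i j
      fin_cases i <;> fin_cases j <;>
        simp [h₁₂, h₁₃, h₂₃, h₁₂.symm, h₁₃.symm, h₂₃.symm, h₄₁, h₄₂, h₄₃, h₄₁.symm, h₄₂.symm,
          h₄₃.symm])
  obtain ⟨x, hx⟩ := hcrt ![1, 1, 0, 0]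
  obtain ⟨y, hy⟩ := hcrt ![1, 0, 1, 0]
  obtain ⟨a, b, c, h⟩ := hq.exists_mul_eq x y
  have x1 : x - 1 ∈ P₁ := hx 0
  have x2 : x - 1 ∈ P₂ := hx 1
  have x3 : x - 0 ∈ P₃ := hx 2
  have x4 : x - 0 ∈ P₄ := hx 3
  have y1 : y - 1 ∈ P₁ := hy 0
  have y2 : y - 0 ∈ P₂ := hy 1
  have y3 : y - 1 ∈ P₃ := hy 2
  have y4 : y - 0 ∈ P₄ := hy 3
  rw [sub_zero] at x3 x4 y2 y4
  have hc : c ∈ maximalIdeal R := by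
    rw [← algebraMap_mem_iff_of_isIntegral h₄]
    have : algebraMap R C c = (y - algebraMap R C a) * x - algebraMap R C b * y := by
      linear_combination -h
    rw [this]
    exact P₄.sub_mem (P₄.mul_mem_left _ x4) (P₄.mul_mem_left _ y4)
  have ha : a ∈ maximalIdeal R := by
    rw [← algebraMap_mem_iff_of_isIntegral h₂]
    have : algebraMap R C a = (x - algebraMap R C b) * y - algebraMap R C a * (x - 1)
        - algebraMap R C c := by
      linear_combination -h
    rw [this]
    exact P₂.sub_mem (P₂.sub_mem (P₂.mul_mem_left _ y2) (P₂.mul_mem_left _ x2))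
      ((algebraMap_mem_iff_of_isIntegral h₂).2 hc)
  have hb : b ∈ maximalIdeal R := by
    rw [← algebraMap_mem_iff_of_isIntegral h₃]
    have : algebraMap R C b = (y - algebraMap R C a) * x - algebraMap R C b * (y - 1)
        - algebraMap R C c := by
      linear_combination -h
    rw [this]
    exact P₃.sub_mem (P₃.sub_mem (P₃.mul_mem_left _ x3) (P₃.mul_mem_left _ y3))
      ((algebraMap_mem_iff_of_isIntegral h₃).2 hc)
  refine h₁.ne_top ((Ideal.eq_top_iff_one _).2 ?_)
  have : (1 : C) = x * algebraMap R C a + y * algebraMap R C b + algebraMap R C c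
      - (x - 1) * y - (y - 1) := by
    linear_combination h
  rw [this]
  have hm {r : R} (hr : r ∈ maximalIdeal R) := (algebraMap_mem_iff_of_isIntegral h₁).2 hr
  exact P₁.sub_mem (P₁.sub_mem (P₁.add_mem (P₁.add_mem (P₁.mul_mem_left _ (hm ha))
    (P₁.mul_mem_left _ (hm hb))) (hm hc)) (P₁.mul_mem_right _ x1)) y1

theorem IsQuadraticExtension.mem_or_sub_one_mem (hq : IsQuadraticExtension R C)
    {P₁ P₂ P₃ : Ideal C} (h₁ : P₁.IsMaximal) (h₂ : P₂.IsMaximal)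
    (h₃ : P₃.IsMaximal) (h₁₂ : P₁ ≠ P₂) (h₁₃ : P₁ ≠ P₃) (h₂₃ : P₂ ≠ P₃) (z : C) :
    z ∈ P₁ ∨ z - 1 ∈ P₁ := by
  have := hq.isIntegral
  by_contra! hne
  obtain ⟨hz, hz1⟩ := hne
  -- the congruences satisfied by the coefficients of `x * y`
  have key : ∀ w : C, ∃ a b c : R, algebraMap R C a * z + algebraMap R C c ∈ P₁ ∧
      a + b + c - 1 ∈ maximalIdeal R ∧ algebraMap R C b * w + algebraMap R C c ∈ P₃ := by
    intro w
    obtain ⟨x, x1, x2, x3⟩ := exists_congruences h₁ h₂ h₃ h₁₂ h₁₃ h₂₃ z 1 0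
    obtain ⟨y, y1, y2, y3⟩ := exists_congruences h₁ h₂ h₃ h₁₂ h₁₃ h₂₃ 0 1 w
    obtain ⟨a, b, c, h⟩ := hq.exists_mul_eq x y
    rw [sub_zero] at x3 y1
    refine ⟨a, b, c, ?_, ?_, ?_⟩
    · have : algebraMap R C a * z + algebraMap R C c =
          (x - algebraMap R C b) * y - algebraMap R C a * (x - z) := by
        linear_combination -h
      rw [this]
      exact P₁.sub_mem (P₁.mul_mem_left _ y1) (P₁.mul_mem_left _ x1)
    · rw [← algebraMap_mem_iff_of_isIntegral h₂]
      have : algebraMap R C (a + b + c - 1) =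
          (y - algebraMap R C a) * (x - 1) + (1 - algebraMap R C b) * (y - 1) := by
        simp only [map_sub, map_add, map_one]
        linear_combination -h
      rw [this]
      exact P₂.add_mem (P₂.mul_mem_left _ x2) (P₂.mul_mem_left _ y2)
    · have : algebraMap R C b * w + algebraMap R C c =
          (y - algebraMap R C a) * x - algebraMap R C b * (y - w) := by
        linear_combination -h
      rw [this]
      exact P₃.sub_mem (P₃.mul_mem_left _ x3) (P₃.mul_mem_left _ y3)
  -- `z` is congruent to an element of `R`
  obtain ⟨l, hl⟩ : ∃ l : R, z - algebraMap R C l ∈ P₁ := by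
    obtain ⟨a, b, c, ha, hb, hc⟩ := key 1
    rw [mul_one, ← map_add, algebraMap_mem_iff_of_isIntegral h₃] at hc
    have hu : IsUnit a := by
      by_contra hn
      have : (1 : R) ∈ maximalIdeal R := by
        have h1 : (1 : R) = a + (b + c) - (a + b + c - 1) := by ring
        rw [h1]
        exact Ideal.sub_mem _ (Ideal.add_mem _ ((mem_maximalIdeal a).2 hn) hc) hb
      exact (mem_maximalIdeal 1).1 this isUnit_one
    obtain ⟨u, rfl⟩ := hu
    refine ⟨-(↑u⁻¹ * c), ?_⟩
    have h1 : algebraMap R C ↑u⁻¹ * algebraMap R C ↑u = 1 := by rw [← map_mul]; simp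
    have : z - algebraMap R C (-(↑u⁻¹ * c)) =
        algebraMap R C ↑u⁻¹ * (algebraMap R C ↑u * z + algebraMap R C c) := by
      rw [map_neg, map_mul]
      linear_combination -z * h1
    rw [this]
    exact P₁.mul_mem_left _ ha
  have hu : IsUnit l := by
    by_contra hn
    refine hz ?_
    have := P₁.add_mem hl ((algebraMap_mem_iff_of_isIntegral h₁).2 ((mem_maximalIdeal l).2 hn))
    rwa [sub_add_cancel] at this
  have hu1 : IsUnit (l - 1) := by
    by_contra hn
    refine hz1 ?_
    have := P₁.add_mem hl ((algebraMap_mem_iff_of_isIntegral h₁).2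
      ((mem_maximalIdeal (l - 1)).2 hn))
    rwa [map_sub, map_one, sub_add_sub_cancel] at this
  obtain ⟨u, hu⟩ := hu
  obtain ⟨v, hv⟩ := hu1
  -- The choice `w = l / (l - 1)` makes the system inconsistent: `c = -al` and `b = a(l - 1)` give
  -- `a + b + c = 0`, not `1`.
  obtain ⟨a, b, c, ha, hb, hc⟩ := key (algebraMap R C (l * ↑v⁻¹))
  rw [← map_mul, ← map_add, algebraMap_mem_iff_of_isIntegral h₃] at hc
  have ha' : a * l + c ∈ maximalIdeal R := by
    rw [← algebraMap_mem_iff_of_isIntegral h₁]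
    have : algebraMap R C (a * l + c) = algebraMap R C a * z + algebraMap R C c
        - algebraMap R C a * (z - algebraMap R C l) := by
      rw [map_add, map_mul]
      ring
    rw [this]
    exact P₁.sub_mem ha (P₁.mul_mem_left _ hl)
  have hvi : (l - 1) * ↑v⁻¹ = 1 := by rw [← hv]; simp
  have hli : l * ↑u⁻¹ = 1 := by rw [← hu]; simp
  have : (1 : R) ∈ maximalIdeal R := by
    have h1 : (1 : R) = ↑u⁻¹ * (a * l + c) + (l - 1) * ↑u⁻¹ * (b * (l * ↑v⁻¹) + c)
        - (a + b + c - 1) := by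
      linear_combination -(a + c + b * (l - 1) * ↑v⁻¹) * hli - b * hvi
    rw [h1]
    exact Ideal.sub_mem _ (Ideal.add_mem _ (Ideal.mul_mem_left _ _ ha')
      (Ideal.mul_mem_left _ _ hc)) hb
  exact (mem_maximalIdeal 1).1 this isUnit_one

/-- Squares come first: in `m² = am + c` the residue at any maximal ideal puts `c` in the maximal
ideal of `R`, and if `a` is a unit then so is `m - a`, whence `m` itself lies in the extended ideal.
For a product `nn' = an + bn' + c` with a unit coefficient, multiplying by `n` or `n'` reduces to
squares. -/
theorem IsQuadraticExtension.mul_mem_of_mem_jacobson (hq : IsQuadraticExtension R C)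
    {n n' : C} (hn : n ∈ Ideal.jacobson (⊥ : Ideal C)) (hn' : n' ∈ Ideal.jacobson (⊥ : Ideal C)) :
    n * n' ∈ (maximalIdeal R).map (algebraMap R C) := by
  have := hq.isIntegral
  rcases subsingleton_or_nontrivial C with _ | _
  · rw [Subsingleton.elim (n * n') 0]
    exact zero_mem _
  obtain ⟨P, hP⟩ := Ideal.exists_maximal C
  set MC := (maximalIdeal R).map (algebraMap R C)
  have hM {r : R} (hr : r ∈ maximalIdeal R) : algebraMap R C r ∈ MC := Ideal.mem_map_of_mem _ hr
  have hsq : ∀ m ∈ Ideal.jacobson (⊥ : Ideal C), m * m ∈ MC := by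
    intro m hm
    obtain ⟨a, c, h⟩ := hq.exists_sq_eq m
    have hc : c ∈ maximalIdeal R := by
      rw [← algebraMap_mem_iff_of_isIntegral hP]
      have : algebraMap R C c = (m - algebraMap R C a) * m := by linear_combination -h
      rw [this]
      exact P.mul_mem_left _ (jacobson_bot_le_of_isMaximal hP hm)
    by_cases ha : IsUnit a
    · have hu : IsUnit (m - algebraMap R C a) := by
        obtain ⟨u, rfl⟩ := ha
        have h1 : algebraMap R C ↑u * algebraMap R C ↑u⁻¹ = 1 := by rw [← map_mul]; simp
        have h2 := Ideal.mem_jacobson_bot.1 hm (-algebraMap R C ↑u⁻¹)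
        have h3 : m - algebraMap R C ↑u =
            -algebraMap R C ↑u * (m * -algebraMap R C ↑u⁻¹ + 1) := by
          linear_combination -m * h1
        rw [h3]
        exact IsUnit.mul ((u.isUnit.map _).neg) h2
      have h4 : m ∈ MC := by
        rw [← Ideal.unit_mul_mem_iff_mem MC hu]
        have h5 : (m - algebraMap R C a) * m = algebraMap R C c := by linear_combination h
        rw [h5]
        exact hM hc
      exact MC.mul_mem_left _ h4
    · rw [h]
      exact MC.add_mem (MC.mul_mem_right _ (hM ((mem_maximalIdeal a).2 ha))) (hM hc)
  obtain ⟨a, b, c, h⟩ := hq.exists_mul_eq n n'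
  have hc : c ∈ maximalIdeal R := by
    rw [← algebraMap_mem_iff_of_isIntegral hP]
    have : algebraMap R C c = (n' - algebraMap R C a) * n - algebraMap R C b * n' := by
      linear_combination -h
    rw [this]
    exact P.sub_mem (P.mul_mem_left _ (jacobson_bot_le_of_isMaximal hP hn))
      (P.mul_mem_left _ (jacobson_bot_le_of_isMaximal hP hn'))
  have hunit {r : R} (hr : IsUnit r) (hrm : algebraMap R C r * (n * n') ∈ MC) : n * n' ∈ MC := by
    obtain ⟨u, rfl⟩ := hr
    have h1 : algebraMap R C ↑u⁻¹ * algebraMap R C ↑u = 1 := by rw [← map_mul]; simp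
    have := MC.mul_mem_left (algebraMap R C ↑u⁻¹) hrm
    rwa [← mul_assoc, h1, one_mul] at this
  by_cases hb : IsUnit b
  · apply hunit hb
    have : algebraMap R C b * (n * n') = (n' - algebraMap R C a) * (n * n)
        - n * algebraMap R C c := by
      linear_combination -n * h
    rw [this]
    exact MC.sub_mem (MC.mul_mem_left _ (hsq n hn)) (MC.mul_mem_left _ (hM hc))
  by_cases ha : IsUnit a
  · apply hunit ha
    have : algebraMap R C a * (n * n') = (n - algebraMap R C b) * (n' * n')
        - n' * algebraMap R C c := by
      linear_combination -n' * h
    rw [this]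
    exact MC.sub_mem (MC.mul_mem_left _ (hsq n' hn')) (MC.mul_mem_left _ (hM hc))
  rw [h]
  exact MC.add_mem (MC.add_mem (MC.mul_mem_right _ (hM ((mem_maximalIdeal a).2 ha)))
    (MC.mul_mem_right _ (hM ((mem_maximalIdeal b).2 hb)))) (hM hc)

/-- In a quadratic algebra with two maximal ideals `P₁ ≠ P₂`, an element that is `1` modulo `P₁`
and `0` modulo `P₂` is idempotent and annihilates the Jacobson radical, modulo the extension of
the maximal ideal of the base. -/
theorem IsQuadraticExtension.mul_mem_of_isMaximal_of_ne (hq : IsQuadraticExtension R C)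
    {P₁ P₂ : Ideal C} (h₁ : P₁.IsMaximal) (h₂ : P₂.IsMaximal)
    {e n : C} (he₁ : e - 1 ∈ P₁) (he₂ : e ∈ P₂) (hn : n ∈ Ideal.jacobson (⊥ : Ideal C)) :
    e * n ∈ (maximalIdeal R).map (algebraMap R C) := by
  have := hq.isIntegral
  set MC := (maximalIdeal R).map (algebraMap R C)
  have hM {r : R} (hr : r ∈ maximalIdeal R) : algebraMap R C r ∈ MC := Ideal.mem_map_of_mem _ hr
  have hsq := hq.mul_mem_of_mem_jacobson hn hn
  have hn1 := jacobson_bot_le_of_isMaximal h₁ hn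
  have hn2 := jacobson_bot_le_of_isMaximal h₂ hn
  have hidem : e * e - e ∈ MC := by
    obtain ⟨a, c, h⟩ := hq.exists_sq_eq e
    have hc : c ∈ maximalIdeal R := by
      rw [← algebraMap_mem_iff_of_isIntegral h₂]
      have : algebraMap R C c = (e - algebraMap R C a) * e := by linear_combination -h
      rw [this]
      exact P₂.mul_mem_left _ he₂
    have ha : a + c - 1 ∈ maximalIdeal R := by
      rw [← algebraMap_mem_iff_of_isIntegral h₁]
      have : algebraMap R C (a + c - 1) = (e + 1 - algebraMap R C a) * (e - 1) := by
        simp only [map_sub, map_add, map_one]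
        linear_combination -h
      rw [this]
      exact P₁.mul_mem_left _ he₁
    have : e * e - e = e * algebraMap R C (a + c - 1) + (1 - e) * algebraMap R C c := by
      simp only [map_sub, map_add, map_one]
      linear_combination h
    rw [this]
    exact MC.add_mem (MC.mul_mem_left _ (hM ha)) (MC.mul_mem_left _ (hM hc))
  -- Put `x = e(1 + n)`. Modulo `MC`, where `e² = e` and `n² = 0`, the product `x(1 - x)` is `-en`.
  -- The relation equals `(a + c)x + (b + c)(1 - x)`, and both coefficients have zero residue.
  obtain ⟨a, b, c, h⟩ := hq.exists_mul_eq (e + e * n) (1 - e - e * n)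
  have hac : a + c ∈ maximalIdeal R := by
    rw [← algebraMap_mem_iff_of_isIntegral h₁]
    have : algebraMap R C (a + c) = (algebraMap R C b - algebraMap R C a - e - e * n) * (e - 1)
        + (-algebraMap R C a * e + algebraMap R C b * e - (e + e * n) * e) * n := by
      simp only [map_add]
      linear_combination -h
    rw [this]
    exact P₁.add_mem (P₁.mul_mem_left _ he₁) (P₁.mul_mem_left _ hn1)
  have hbc : b + c ∈ maximalIdeal R := by
    rw [← algebraMap_mem_iff_of_isIntegral h₂]
    have : algebraMap R C (b + c) = ((1 + n) * (1 - e - e * n) - algebraMap R C a * (1 + n)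
        + algebraMap R C b * (1 + n)) * e := by
      simp only [map_add]
      linear_combination -h
    rw [this]
    exact P₂.mul_mem_left _ he₂
  have : e * n = -((1 + n) ^ 2) * (e * e - e) - e * (n * n)
      - (e + e * n) * algebraMap R C (a + c) - (1 - e - e * n) * algebraMap R C (b + c) := by
    simp only [map_add]
    linear_combination -h
  rw [this]
  exact MC.sub_mem (MC.sub_mem (MC.sub_mem (MC.mul_mem_left _ hidem) (MC.mul_mem_left _ hsq))
    (MC.mul_mem_left _ (hM hac))) (MC.mul_mem_left _ (hM hbc))

theorem IsQuadraticExtension.jacobson_eq_of_ne (hq : IsQuadraticExtension R C)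
    {P₁ P₂ : Ideal C} (h₁ : P₁.IsMaximal) (h₂ : P₂.IsMaximal) (hne : P₁ ≠ P₂) :
    Ideal.jacobson (⊥ : Ideal C) = (maximalIdeal R).map (algebraMap R C) := by
  have := hq.isIntegral
  refine le_antisymm (fun n hn => ?_) map_maximalIdeal_le_jacobson
  obtain ⟨e, he₁, he₂⟩ := exists_congruences_pair h₁ h₂ hne 1 0
  rw [sub_zero] at he₂
  have h3 := hq.mul_mem_of_isMaximal_of_ne h₁ h₂ he₁ he₂ hn
  have h4 := hq.mul_mem_of_isMaximal_of_ne h₂ h₁ (e := 1 - e) (by simpa using he₂)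
    (by rw [← neg_mem_iff]; simpa using he₁) hn
  have := add_mem h3 h4
  rwa [← add_mul, add_sub_cancel, one_mul] at this

end QuadraticAlgebra

/-! ### Counting maximal ideals and residue fields with two elements -/

section MaximalIdeals

/-- In the second alternative the two ideals may coincide, so the local case is included. -/
theorem exists_three_or_forall_eq_or_eq (C : Type*) [CommRing C] [Nontrivial C] :
    (∃ P₁ P₂ P₃ : Ideal C, P₁.IsMaximal ∧ P₂.IsMaximal ∧ P₃.IsMaximal ∧ P₁ ≠ P₂ ∧ P₁ ≠ P₃ ∧
      P₂ ≠ P₃) ∨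
    ∃ P₁ P₂ : Ideal C, P₁.IsMaximal ∧ P₂.IsMaximal ∧ ∀ P : Ideal C, P.IsMaximal →
      P = P₁ ∨ P = P₂ := by
  obtain ⟨P₁, h₁⟩ := Ideal.exists_maximal C
  by_cases h : ∃ P₂ : Ideal C, P₂.IsMaximal ∧ P₁ ≠ P₂
  · obtain ⟨P₂, h₂, h₁₂⟩ := h
    by_cases h' : ∃ P₃ : Ideal C, P₃.IsMaximal ∧ P₁ ≠ P₃ ∧ P₂ ≠ P₃
    · obtain ⟨P₃, h₃, h₁₃, h₂₃⟩ := h'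
      exact .inl ⟨P₁, P₂, P₃, h₁, h₂, h₃, h₁₂, h₁₃, h₂₃⟩
    · push Not at h'
      refine .inr ⟨P₁, P₂, h₁, h₂, fun P hP => ?_⟩
      by_cases hP1 : P₁ = P
      · exact .inl hP1.symm
      · exact .inr (h' P hP hP1).symm
  · push Not at h
    exact .inr ⟨P₁, P₁, h₁, h₁, fun P hP => .inl (h P hP).symm⟩

variable {R C : Type*} [CommRing R] [CommRing C] [Algebra R C] [IsLocalRing R]

theorem IsQuadraticExtension.setOf_isMaximal_eq (hq : IsQuadraticExtension R C)
    {P₁ P₂ P₃ : Ideal C} (h₁ : P₁.IsMaximal) (h₂ : P₂.IsMaximal)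
    (h₃ : P₃.IsMaximal) (h₁₂ : P₁ ≠ P₂) (h₁₃ : P₁ ≠ P₃) (h₂₃ : P₂ ≠ P₃) :
    {P : Ideal C | P.IsMaximal} = {P₁, P₂, P₃} := by
  ext P
  simp only [Set.mem_ofPred_eq, Set.mem_insert_iff, Set.mem_singleton_iff]
  refine ⟨fun hP => hq.eq_or_eq_of_isMaximal h₁ h₂ h₃ hP h₁₂ h₁₃ h₂₃, ?_⟩
  rintro (rfl | rfl | rfl) <;> assumption

theorem IsQuadraticExtension.finite_isMaximal (hq : IsQuadraticExtension R C) :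
    {P : Ideal C | P.IsMaximal}.Finite := by
  rcases subsingleton_or_nontrivial C with _ | _
  · exact Set.toFinite _
  rcases exists_three_or_forall_eq_or_eq C with
    ⟨P₁, P₂, P₃, h₁, h₂, h₃, h₁₂, h₁₃, h₂₃⟩ | ⟨P₁, P₂, -, -, h⟩
  · rw [hq.setOf_isMaximal_eq h₁ h₂ h₃ h₁₂ h₁₃ h₂₃]
    exact Set.toFinite _
  · exact (Set.toFinite {P₁, P₂}).subset fun P hP => h P hP

theorem nonempty_ringEquiv_zmod_two {C : Type*} [CommRing C] {P : Ideal C} (hP : P ≠ ⊤)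
    (h : ∀ z : C, z ∈ P ∨ z - 1 ∈ P) : Nonempty (C ⧸ P ≃+* ZMod 2) := by
  have : Nontrivial (C ⧸ P) := Ideal.Quotient.nontrivial_iff.2 hP
  have huniv : (Set.univ : Set (C ⧸ P)) = {0, 1} := by
    symm
    rw [Set.eq_univ_iff_forall]
    intro x
    obtain ⟨z, rfl⟩ := Ideal.Quotient.mk_surjective x
    rcases h z with hz | hz
    · exact .inl (Ideal.Quotient.eq_zero_iff_mem.2 hz)
    · exact .inr ((Ideal.Quotient.mk_eq_mk_iff_sub_mem _ _).2 hz)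
  have hcard : Nat.card (C ⧸ P) = 2 := by
    rw [← Set.ncard_univ, huniv, Set.ncard_pair zero_ne_one]
  have : Finite (C ⧸ P) := Nat.finite_of_card_ne_zero (by omega)
  have := Fintype.ofFinite (C ⧸ P)
  exact ⟨(ZMod.ringEquivOfPrime (C ⧸ P) Nat.prime_two
    (by rw [← Nat.card_eq_fintype_card, hcard])).symm⟩

theorem mem_or_sub_one_mem_of_ringEquiv_zmod_two {C : Type*} [CommRing C] {P : Ideal C}
    (e : C ⧸ P ≃+* ZMod 2) (z : C) : z ∈ P ∨ z - 1 ∈ P := by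
  have h : ∀ x : ZMod 2, x = 0 ∨ x = 1 := by decide
  rcases h (e (Ideal.Quotient.mk P z)) with h | h
  · exact .inl (Ideal.Quotient.eq_zero_iff_mem.1 ((map_eq_zero_iff e e.injective).1 h))
  · exact .inr ((Ideal.Quotient.mk_eq_mk_iff_sub_mem _ _).1
      ((map_eq_one_iff e e.injective).1 h))

end MaximalIdeals

/-! ### Principal regular ideals -/

section Principal

variable {C : Type*} [CommRing C]

theorem isUnit_coeIdeal_span_singleton {b : C} (hb : b ∈ C⁰) :
    IsUnit ((Ideal.span {b} : Ideal C) : FractionalIdeal C⁰ (FractionRing C)) := by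
  rw [FractionalIdeal.coeIdeal_span_singleton]
  have hu : IsUnit (algebraMap C (FractionRing C) b) :=
    IsLocalization.map_units (FractionRing C) (⟨b, hb⟩ : C⁰)
  obtain ⟨u, hu⟩ := hu
  rw [← hu]
  refine .of_mul_eq_one
    (FractionalIdeal.spanSingleton C⁰ ((u⁻¹ : (FractionRing C)ˣ) : FractionRing C)) ?_
  rw [FractionalIdeal.spanSingleton_mul_spanSingleton]
  simp

theorem mem_nonZeroDivisors_of_dvd {a b : C} (h : b ∣ a) (ha : a ∈ C⁰) : b ∈ C⁰ := by
  obtain ⟨c, rfl⟩ := h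
  exact (mul_mem_nonZeroDivisors.1 ha).1

theorem IsDedekindWithZeroDivisors.exists_eq_span {C : Type*} [CommRing C]
    (h : IsDedekindWithZeroDivisors C)
    (hf : {P : Ideal C | P.IsMaximal}.Finite) {I : Ideal C} (hI : IsRegularIdeal I) :
    ∃ b ∈ C⁰, I = Ideal.span {b} := by
  obtain ⟨b, hb⟩ := (Ideal.IsPrincipal.of_finite_maximals_of_isUnit hf (h I hI)).principal
  obtain ⟨x, hx, hxr⟩ := hI
  replace hb : I = Ideal.span {b} := hb
  refine ⟨b, ?_, hb⟩
  rw [hb, Ideal.mem_span_singleton] at hx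
  exact mem_nonZeroDivisors_of_dvd hx hxr

/-- If `P` is maximal, generated by a nonzerodivisor, and every ideal containing `J` is generated
by a nonzerodivisor, then so is every ideal containing `P * J`. -/
theorem exists_eq_span_of_mul_le {P J K : Ideal C} (hP : P.IsMaximal)
    (hPs : ∃ p ∈ C⁰, P = Ideal.span {p})
    (hJ : ∀ K : Ideal C, J ≤ K → ∃ b ∈ C⁰, K = Ideal.span {b}) (hK : P * J ≤ K) :
    ∃ b ∈ C⁰, K = Ideal.span {b} := by
  -- If `K ⊆ P = (p)`, then `K = pK'` with `J ⊆ K'`. Otherwise `K + P` is the whole ring, and `PJ ⊆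
  -- K` already gives `J ⊆ K`.
  by_cases hKP : K ≤ P
  · obtain ⟨p, hp, rfl⟩ := hPs
    let K' : Ideal C := Submodule.comap (LinearMap.mulLeft C p) K
    obtain ⟨b, hb, hb'⟩ := hJ K' fun x hx =>
      hK (Ideal.mul_mem_mul (Ideal.mem_span_singleton_self p) hx)
    refine ⟨p * b, mul_mem hp hb, le_antisymm (fun x hx => ?_) ?_⟩
    · obtain ⟨y, rfl⟩ := Ideal.mem_span_singleton.1 (hKP hx)
      have hy : y ∈ K' := hx
      rw [hb', Ideal.mem_span_singleton] at hy
      exact Ideal.mem_span_singleton.2 (mul_dvd_mul_left p hy)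
    · rw [Ideal.span_singleton_le_iff_mem]
      have : b ∈ K' := hb' ▸ Ideal.mem_span_singleton_self b
      exact this
  · refine hJ K fun x hx => ?_
    have h1 : K ⊔ P = ⊤ :=
      hP.out.2 _ (right_lt_sup.2 hKP)
    obtain ⟨k, hk, p, hp, hkp⟩ := Submodule.mem_sup.1 ((Ideal.eq_top_iff_one _).1 h1)
    have : x = k * x + p * x := by rw [← add_mul, hkp, one_mul]
    rw [this]
    exact K.add_mem (K.mul_mem_right _ hk) (hK (Ideal.mul_mem_mul hp hx))

/-- The finitely many maximal ideals multiply to the radical `(j)`, so each is invertible, hence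
principal. Primes over a nonzerodivisor `y ∈ K` are maximal, so `j` is in the radical of `(y)` and
`K` contains some `jⁿ`. -/
theorem exists_eq_span_of_jacobson_eq (hf : {P : Ideal C | P.IsMaximal}.Finite) {j : C}
    (hj : j ∈ C⁰) (hjac : Ideal.jacobson (⊥ : Ideal C) = Ideal.span {j})
    (hdim : ∀ y ∈ C⁰, ∀ P : Ideal C, P.IsPrime → y ∈ P → P.IsMaximal)
    {K : Ideal C} (hK : IsRegularIdeal K) : ∃ b ∈ C⁰, K = Ideal.span {b} := by
  classical
  set s := hf.toFinset
  have hs {P : Ideal C} : P ∈ s ↔ P.IsMaximal := by simp [s]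
  have hprod : ∏ P ∈ s, P = Ideal.span {j} := by
    rw [Ideal.prod_eq_iInf_of_pairwise_isCoprime (J := fun P => P), ← hjac]
    · refine le_antisymm (le_sInf fun P hP => ?_) ?_
      · exact iInf₂_le P (hs.2 hP.2)
      · exact le_iInf₂ fun P hP => jacobson_bot_le_of_isMaximal (hs.1 hP)
    · intro P hP P' hP' hne
      have := hs.1 hP
      have := hs.1 hP'
      exact Ideal.isCoprime_of_isMaximal hne
  have hPs : ∀ P ∈ s, ∃ p ∈ C⁰, P = Ideal.span {p} := by
    intro P hP
    have hu : IsUnit (P : FractionalIdeal C⁰ (FractionRing C)) := by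
      have := isUnit_coeIdeal_span_singleton hj
      rw [← hprod, ← Finset.mul_prod_erase s _ hP, FractionalIdeal.coeIdeal_mul] at this
      exact isUnit_of_mul_isUnit_left this
    obtain ⟨p, hp⟩ := (Ideal.IsPrincipal.of_finite_maximals_of_isUnit hf hu).principal
    replace hp : P = Ideal.span {p} := hp
    refine ⟨p, ?_, hp⟩
    have hjP : j ∈ P :=
      jacobson_bot_le_of_isMaximal (hs.1 hP) (hjac ▸ Ideal.mem_span_singleton_self j)
    rw [hp, Ideal.mem_span_singleton] at hjP
    exact mem_nonZeroDivisors_of_dvd hjP hj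
  -- Multiplying by a good ideal preserves "every larger ideal has a regular generator". Goodness
  -- passes to products, hence from the maximal ideals to `(jⁿ)`; the start is `J = ⊤`.
  let good : Ideal C → Prop := fun I => ∀ J : Ideal C,
    (∀ K : Ideal C, J ≤ K → ∃ b ∈ C⁰, K = Ideal.span {b}) →
      ∀ K : Ideal C, I * J ≤ K → ∃ b ∈ C⁰, K = Ideal.span {b}
  have good_mul (I I' : Ideal C) (h : good I) (h' : good I') : good (I * I') := by
    intro J hJ K hK
    rw [mul_assoc] at hK
    exact h _ (h' J hJ) K hK
  have good_one : good 1 := fun J hJ K hK => hJ K (by rwa [one_mul] at hK)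
  have good_j : good (Ideal.span {j}) := by
    rw [← hprod]
    exact Finset.prod_induction _ good good_mul good_one fun P hP J hJ K hK =>
      exists_eq_span_of_mul_le (hs.1 hP) (hPs P hP) hJ hK
  have good_pow : ∀ n : ℕ, good (Ideal.span {j} ^ n) := by
    intro n
    induction n with
    | zero => rwa [pow_zero]
    | succ n ih =>
      rw [pow_succ]
      exact good_mul _ _ ih good_j
  obtain ⟨y, hy, hyr⟩ := hK
  have hrad : j ∈ (Ideal.span {y}).radical := by
    rw [Ideal.radical_eq_sInf]
    refine Submodule.mem_sInf.2 fun P hP => ?_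
    have hPm := hdim y hyr P hP.2 (hP.1 (Ideal.mem_span_singleton_self y))
    exact jacobson_bot_le_of_isMaximal hPm (hjac ▸ Ideal.mem_span_singleton_self j)
  obtain ⟨n, hn⟩ := hrad
  refine good_pow n ⊤ (fun K hK => ⟨1, one_mem _, ?_⟩) K ?_
  · rw [Ideal.span_singleton_one]
    exact top_le_iff.1 hK
  · rw [Ideal.mul_top, Ideal.span_singleton_pow, Ideal.span_singleton_le_iff_mem]
    exact (Ideal.span_singleton_le_iff_mem K).2 hy hn

end Principal

/-! ### A Krull intersection argument -/

section Powers

/-- A form of Krull's intersection theorem for finitely generated ideals of a ring in which the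
primes over a nonzerodivisor `d` are maximal. -/
theorem exists_notMem_pow_of_fg {E : Type*} [CommRing E] {d : E} (hd : d ∈ E⁰)
    (hdim : ∀ P : Ideal E, P.IsPrime → d ∈ P → P.IsMaximal) {P : Ideal E} (hP : P.IsPrime)
    (hdP : d ∈ P) {I : Ideal E} (hI : I.FG) (hIP : I ≤ P) : ∃ n : ℕ, d ∉ I ^ n := by
  let L := Localization.AtPrime P
  let f := algebraMap E L
  have hcomap : (IsLocalRing.maximalIdeal L).comap f = P :=
    Localization.AtPrime.under_maximalIdeal
  -- A prime of the localization containing `d` contracts to a maximal ideal inside `P`, that is, to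
  -- `P`. The square matters: `d ∈ Iⁿ` will give `d = d²c` locally, which forces `d = 0` there.
  have hrad : I.map f ≤ (Ideal.span {f d ^ 2}).radical := by
    rw [Ideal.radical_eq_sInf]
    refine le_sInf fun Q hQ => ?_
    have := hQ.2
    have hle : Q.comap f ≤ P := by
      have := Ideal.comap_mono (f := f) (IsLocalRing.le_maximalIdeal hQ.2.ne_top)
      rwa [hcomap] at this
    have hdQ : d ∈ Q.comap f :=
      hQ.2.mem_of_pow_mem 2 (hQ.1 (Ideal.mem_span_singleton_self _))
    have hmax := hdim _ (Ideal.comap_isPrime f Q) hdQ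
    rw [Ideal.map_le_iff_le_comap, hmax.eq_of_le hP.ne_top hle]
    exact hIP
  obtain ⟨n, hn⟩ := Ideal.exists_pow_le_of_le_radical_of_fg hrad (hI.map f)
  refine ⟨n, fun hdn => ?_⟩
  have h1 : f d ∈ Ideal.span {f d ^ 2} := by
    apply hn
    rw [← Ideal.map_pow]
    exact Ideal.mem_map_of_mem f hdn
  obtain ⟨c, hc⟩ := Ideal.mem_span_singleton.1 h1
  have hdm : f d ∈ IsLocalRing.maximalIdeal L := by
    rw [← Ideal.mem_comap, hcomap]
    exact hdP
  have hunit : IsUnit (1 - f d * c) := by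
    by_contra h
    have h2 := (IsLocalRing.mem_maximalIdeal _).2 h
    have h3 := add_mem h2 (Ideal.mul_mem_right c _ hdm)
    rw [sub_add_cancel] at h3
    exact (IsLocalRing.mem_maximalIdeal (1 : L)).1 h3 isUnit_one
  have h0 : f d = 0 := by
    have : f d * (1 - f d * c) = 0 := by linear_combination hc
    exact (hunit.mul_left_eq_zero).1 this
  obtain ⟨s, hs⟩ := (IsLocalization.map_eq_zero_iff P.primeCompl L d).1 h0
  have hs0 : (s : E) = 0 := (mem_nonZeroDivisors_iff_right.1 hd) _ hs
  exact s.2 (hs0 ▸ P.zero_mem)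

end Powers

/-! ### Stable ideals and invertibility over the endomorphism ring -/

section Stable

variable {R : Type*} [CommRing R]

/-- The ratio `f(a)/a` does not depend on `a`: an endomorphism of a regular ideal is multiplication
by a fraction. -/
theorem coe_end_mul_comm {I : Ideal R} (f : Module.End R I) (a b : I) :
    (f a : R) * b = a * f b := by
  have h : (b : R) • f a = (a : R) • f b := by
    rw [← map_smul, ← map_smul]
    congr 1
    ext
    simp [mul_comm]
  have := congrArg (Subtype.val) h
  simpa [mul_comm] using this

/-- If `i ∈ I` is a nonzerodivisor and `I * I = i * I`, then `I` is a free module of rank one over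
its endomorphism ring. -/
theorem isStableIdeal_of_forall_mul {I : Ideal R} {i : R} (hi : i ∈ I) (hreg : i ∈ R⁰)
    (h : ∀ a ∈ I, ∀ b ∈ I, ∃ c ∈ I, a * b = i * c) : IsStableIdeal I := by
  have hcancel {x y : R} (hxy : i * x = i * y) : x = y :=
    (mul_cancel_left_mem_nonZeroDivisors hreg).1 hxy
  let φ : Module.End R I →ₗ[Module.End R I] I :=
    LinearMap.toSpanSingleton (Module.End R I) I ⟨i, hi⟩
  have hφ (f : Module.End R I) : φ f = f ⟨i, hi⟩ := rfl
  have hbij : Function.Bijective φ := by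
    refine ⟨fun f g hfg => ?_, fun a => ?_⟩
    · rw [hφ, hφ] at hfg
      ext a
      apply hcancel
      have h1 := coe_end_mul_comm f a ⟨i, hi⟩
      have h2 := coe_end_mul_comm g a ⟨i, hi⟩
      rw [hfg, ← h2] at h1
      linear_combination h1
    -- The endomorphism sending `i` to `a` is `b ↦ ab / i`.
    · choose c hc hc' using fun b : I => h a a.2 b b.2
      refine ⟨{ toFun := fun b => ⟨c b, hc b⟩, map_add' := ?_, map_smul' := ?_ }, ?_⟩
      · intro b b'
        ext
        apply hcancel
        have h1 := hc' (b + b')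
        have h2 := hc' b
        have h3 := hc' b'
        simp only [Submodule.coe_add] at h1 ⊢
        linear_combination h2 + h3 - h1
      · intro r b
        ext
        apply hcancel
        have h1 := hc' (r • b)
        have h2 := hc' b
        simp only [SetLike.val_smul, smul_eq_mul, RingHom.id_apply] at h1 ⊢
        linear_combination r * h2 - h1
      · rw [hφ]
        ext
        apply hcancel
        have h1 := hc' ⟨i, hi⟩
        simp only [LinearMap.coe_mk, AddHom.coe_mk]
        linear_combination -h1
  exact Module.Projective.of_equiv (LinearEquiv.ofBijective φ hbij)

/-- A regular stable ideal is invertible over the ring `(I : I)`. -/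
theorem IsStableIdeal.exists_sum_eq_one {Q : Type*} [CommRing Q] [Algebra R Q]
    [IsFractionRing R Q] {I : Ideal R} (hI : IsStableIdeal I) (hreg : IsRegularIdeal I) :
    ∃ (s : Finset I) (q : I → Q), ∑ v ∈ s, q v * algebraMap R Q v = 1 ∧
      ∀ v, ∀ a ∈ I, ∀ b ∈ I, ∃ c ∈ I, q v * algebraMap R Q a * algebraMap R Q b =
        algebraMap R Q c := by
  obtain ⟨x, hx, hxr⟩ := hreg
  have hu : IsUnit (algebraMap R Q x) := IsLocalization.map_units Q (⟨x, hxr⟩ : R⁰)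
  obtain ⟨u, hu⟩ := hu
  have hinv : algebraMap R Q x * ((u⁻¹ : Qˣ) : Q) = 1 := by rw [← hu]; simp
  obtain ⟨σ, hσ⟩ := (Module.projective_def'.1 hI :)
  let x' : I := ⟨x, hx⟩
  let w : Q := ((u⁻¹ : Qˣ) : Q)
  -- `σ` is a splitting given by projectivity. Its coordinate at `v`, a map `I → End I`, is
  -- multiplication by a fraction: `(σ x)ᵥ` acts as `(σ x)ᵥ(x)/x`, and one more division by `x`
  -- gives `qᵥ`.
  refine ⟨(σ x').support, fun v => algebraMap R Q ((σ x') v x') * w * w, ?_, ?_⟩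
  · have h1 : ∑ v ∈ (σ x').support, ((σ x') v v : I) = x' := by
      have := LinearMap.congr_fun hσ x'
      simpa [Finsupp.linearCombination_apply, Finsupp.sum] using this
    have h2 : ∑ v ∈ (σ x').support, (((σ x') v v : I) : R) = x := by
      have := congrArg Subtype.val h1
      simpa using this
    have h3 : ∀ v : I, algebraMap R Q ((σ x') v x') * w * w * algebraMap R Q v =
        algebraMap R Q ((σ x') v v) * w := by
      intro v
      have h4 := congrArg (algebraMap R Q) (coe_end_mul_comm ((σ x') v) x' v)
      rw [map_mul, map_mul] at h4
      change _ = algebraMap R Q x * _ at h4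
      linear_combination w * w * h4 + algebraMap R Q ((σ x') v v) * w * hinv
    rw [Finset.sum_congr rfl fun v _ => h3 v, ← Finset.sum_mul, ← map_sum, h2, hinv]
  · intro v a ha b hb
    let a' : I := ⟨a, ha⟩
    let b' : I := ⟨b, hb⟩
    refine ⟨(σ a') v b', ((σ a') v b').2, ?_⟩
    have hsm (r s : I) : ((r : R) • LinearMap.id : Module.End R I) • s = (r : R) • s := rfl
    have h1 : ((a : R) • LinearMap.id : Module.End R I) • x' =
        ((x : R) • LinearMap.id : Module.End R I) • a' := by
      rw [hsm a' x', hsm x' a']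
      ext
      simp [x', a', mul_comm]
    have h2 := congrArg σ h1
    rw [map_smul, map_smul] at h2
    have h3 := LinearMap.congr_fun (DFunLike.congr_fun h2 v) b'
    have h4 : a * ((σ x') v b' : R) = x * ((σ a') v b' : R) := by
      have := congrArg Subtype.val h3
      simpa using this
    have h5 := coe_end_mul_comm ((σ x') v) x' b'
    have h6 := congrArg (algebraMap R Q) h4
    have h7 := congrArg (algebraMap R Q) h5
    rw [map_mul, map_mul] at h6 h7
    change _ * algebraMap R Q b = algebraMap R Q x * _ at h7
    linear_combination algebraMap R Q a * w * w * h7 + algebraMap R Q x * w * w * h6 +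
      (algebraMap R Q ((σ a') v b')) * (algebraMap R Q x * w + 1) * hinv

end Stable

/-! ### Rings between `R` and `Q`, and the tower -/

section Tower

variable {R Q : Type*} [CommRing R] [CommRing Q] [Algebra R Q]

theorem mem_jac {C : Subalgebra R Q} {q : Q} :
    q ∈ jac C ↔ ∃ x : C, x ∈ Ideal.jacobson (⊥ : Ideal C) ∧ (x : Q) = q := Iff.rfl

theorem coe_mem_jac {C : Subalgebra R Q} {x : C} :
    (x : Q) ∈ jac C ↔ x ∈ Ideal.jacobson (⊥ : Ideal C) := by
  rw [mem_jac]
  exact ⟨fun ⟨y, hy, h⟩ => Subtype.ext h ▸ hy, fun h => ⟨x, h, rfl⟩⟩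

theorem mem_of_mem_jac {C : Subalgebra R Q} {q : Q} (h : q ∈ jac C) : q ∈ C := by
  obtain ⟨x, -, rfl⟩ := h
  exact x.2

theorem mul_mem_jac {C : Subalgebra R Q} {c q : Q} (hc : c ∈ C) (hq : q ∈ jac C) :
    c * q ∈ jac C := by
  obtain ⟨x, hx, rfl⟩ := hq
  exact ⟨⟨c, hc⟩ * x, Ideal.mul_mem_left _ _ hx, rfl⟩

/-- Stated inside `Q`, so that radicals of different rings of the tower can be compared. -/
theorem mem_jac_iff {C : Subalgebra R Q} {q : Q} :
    q ∈ jac C ↔ q ∈ C ∧ ∀ y ∈ C, ∃ z ∈ C, (q * y + 1) * z = 1 := by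
  constructor
  · intro h
    refine ⟨mem_of_mem_jac h, fun y hy => ?_⟩
    obtain ⟨x, hx, rfl⟩ := h
    obtain ⟨z, hz⟩ := isUnit_iff_exists_inv.1 (Ideal.mem_jacobson_bot.1 hx ⟨y, hy⟩)
    exact ⟨z, z.2, congrArg Subtype.val hz⟩
  · rintro ⟨hq, h⟩
    refine ⟨⟨q, hq⟩, Ideal.mem_jacobson_bot.2 fun y => ?_, rfl⟩
    obtain ⟨z, hz, hz'⟩ := h y y.2
    exact isUnit_iff_exists_inv.2 ⟨⟨z, hz⟩, Subtype.ext hz'⟩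

theorem le_endRing_jac (C : Subalgebra R Q) : C ≤ endRing (jac C) :=
  fun _ hc _ hx => mul_mem_jac hc hx

variable (R Q) in
theorem tower_zero : tower R Q 0 = ⊥ := rfl

variable (R Q) in
theorem tower_succ (n : ℕ) : tower R Q (n + 1) = endRing (jac (tower R Q n)) := rfl

variable (R Q) in
theorem tower_monotone : Monotone (tower R Q) :=
  monotone_nat_of_le_succ fun n => le_endRing_jac (tower R Q n)

variable (R Q) in
theorem tower_le_towerTop (n : ℕ) : tower R Q n ≤ towerTop R Q := le_iSup _ n

theorem mem_towerTop {q : Q} : q ∈ towerTop R Q ↔ ∃ n, q ∈ tower R Q n := by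
  rw [← SetLike.mem_coe, towerTop,
    Subalgebra.coe_iSup_of_directed (tower_monotone R Q).directed_le, Set.mem_iUnion]
  rfl

theorem towerTop_eq_of_endRing_eq {n : ℕ} (h : endRing (jac (tower R Q n)) = tower R Q n) :
    towerTop R Q = tower R Q n := by
  have hle : ∀ k, tower R Q (n + k) = tower R Q n := by
    intro k
    induction k with
    | zero => rfl
    | succ k ih => rw [← add_assoc, tower_succ, ih, h]
  refine le_antisymm (fun q hq => ?_) (tower_le_towerTop R Q n)
  obtain ⟨k, hk⟩ := mem_towerTop.1 hq
  rw [← hle k]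
  exact tower_monotone R Q (Nat.le_add_left k n) hk

/-- If `jac C = j C` with `j` a unit of `Q`, then `jac C` has the endomorphism ring `C`. -/
theorem endRing_jac_eq {C : Subalgebra R Q} {j : Q} (hj : IsUnit j)
    (h : ∀ q, q ∈ jac C ↔ ∃ c ∈ C, q = j * c) : endRing (jac C) = C := by
  refine le_antisymm (fun q hq => ?_) (le_endRing_jac C)
  obtain ⟨c, hc, hqc⟩ := (h _).1 (hq j ((h j).2 ⟨1, one_mem C, by ring⟩))
  rwa [hj.mul_left_cancel (b := q) (c := c) (by rw [← hqc, mul_comm])]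

theorem IsQuadraticExtension.of_le {C B : Subalgebra R Q} (hB : IsQuadraticExtension R B)
    (h : C ≤ B) : IsQuadraticExtension R C := by
  intro x y
  obtain ⟨a, b, c, habc⟩ := Submodule.mem_span_triple.1
    (hB ⟨x, h x.2⟩ ⟨y, h y.2⟩)
  refine Submodule.mem_span_triple.2 ⟨a, b, c, Subtype.ext ?_⟩
  exact congrArg (fun z : B => (z : Q)) habc

theorem mem_nonZeroDivisors_of_isUnit_coe {C : Subalgebra R Q} {c : C} (hc : IsUnit (c : Q)) :
    c ∈ C⁰ := by
  rw [mem_nonZeroDivisors_iff_right]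
  intro t ht
  apply Subtype.ext
  apply hc.mul_right_cancel
  rw [← Subalgebra.coe_mul, ht]
  simp

variable [IsFractionRing R Q]

theorem isUnit_algebraMap {r : R} (hr : r ∈ R⁰) : IsUnit (algebraMap R Q r) :=
  IsLocalization.map_units Q (⟨r, hr⟩ : R⁰)

theorem isUnit_coe_of_mem_nonZeroDivisors {C : Subalgebra R Q} {c : C} (hc : c ∈ C⁰) :
    IsUnit (c : Q) := by
  obtain ⟨⟨r, s⟩, hrs⟩ := IsLocalization.surj R⁰ (c : Q)
  have hr : r ∈ R⁰ := by
    rw [mem_nonZeroDivisors_iff_right]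
    intro t ht
    have h1 : algebraMap R C t * c = 0 := by
      apply Subtype.ext
      apply (isUnit_algebraMap (Q := Q) s.2).mul_right_cancel
      change algebraMap R Q t * c * _ = 0 * _
      rw [mul_assoc, hrs, ← map_mul, ht, zero_mul, map_zero]
    have h2 := mem_nonZeroDivisors_iff_right.1 hc _ h1
    apply IsFractionRing.injective R Q
    rw [map_zero]
    exact congrArg Subtype.val h2
  exact isUnit_of_mul_isUnit_left (hrs ▸ isUnit_algebraMap (Q := Q) hr)

theorem isFractionRing_subalgebra (C : Subalgebra R Q) : IsFractionRing C Q := by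
  refine (isLocalization_iff C⁰ Q).2 ⟨fun c => isUnit_coe_of_mem_nonZeroDivisors c.2, ?_, ?_⟩
  · intro q
    obtain ⟨⟨r, s⟩, hrs⟩ := IsLocalization.surj R⁰ q
    refine ⟨(algebraMap R C r, ⟨algebraMap R C s, mem_nonZeroDivisors_of_isUnit_coe ?_⟩), hrs⟩
    exact isUnit_algebraMap s.2
  · intro x y h
    exact ⟨1, by rw [Subtype.ext h]⟩

theorem mem_jac_bot_iff [IsLocalRing R] {q : Q} :
    q ∈ jac (⊥ : Subalgebra R Q) ↔ ∃ r ∈ maximalIdeal R, algebraMap R Q r = q := by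
  have hinj := IsFractionRing.injective R Q
  rw [mem_jac_iff]
  constructor
  · rintro ⟨hq, h⟩
    obtain ⟨r, rfl⟩ := Algebra.mem_bot.1 hq
    refine ⟨r, (mem_maximalIdeal r).2 fun hr => ?_, rfl⟩
    obtain ⟨s, hs⟩ := isUnit_iff_exists_inv.1 hr
    obtain ⟨z, -, hz⟩ := h (algebraMap R Q (-s)) (Algebra.mem_bot.2 ⟨_, rfl⟩)
    rw [← map_mul, mul_neg, hs, map_neg, map_one, neg_add_cancel, zero_mul, ← map_zero
      (algebraMap R Q), ← map_one (algebraMap R Q)] at hz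
    exact zero_ne_one (hinj hz)
  · rintro ⟨r, hr, rfl⟩
    refine ⟨Algebra.mem_bot.2 ⟨r, rfl⟩, fun y hy => ?_⟩
    obtain ⟨s, rfl⟩ := Algebra.mem_bot.1 hy
    have hu : IsUnit (r * s + 1) := by
      by_contra hn
      have h1 := Ideal.sub_mem _ ((mem_maximalIdeal _).2 hn) (Ideal.mul_mem_right s _ hr)
      rw [add_sub_cancel_left] at h1
      exact (mem_maximalIdeal (1 : R)).1 h1 isUnit_one
    obtain ⟨z, hz⟩ := isUnit_iff_exists_inv.1 hu
    refine ⟨algebraMap R Q z, Algebra.mem_bot.2 ⟨z, rfl⟩, ?_⟩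
    rw [← map_mul, ← map_one (algebraMap R Q), ← map_add, ← map_mul, hz]

end Tower

/-! ### Where dimension one enters -/

section Dimension

variable {R Q : Type*} [CommRing R] [CommRing Q] [Algebra R Q] [IsFractionRing R Q]

theorem isMaximal_of_mem_of_ringKrullDim_eq_one (hdim : ringKrullDim R = 1) {p : Ideal R}
    (hp : p.IsPrime) {x : R} (hx : x ∈ R⁰) (hxp : x ∈ p) : p.IsMaximal := by
  have h : Ring.KrullDimLE 1 R := Ring.krullDimLE_iff.2 (by rw [hdim]; rfl)
  rcases Ring.krullDimLE_one_iff.1 h p hp with h | h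
  · exact absurd hx (notMem_nonZeroDivisors_of_mem_mem_minimalPrimes hxp h)
  · exact h

/-- Writing `y⁻¹ = a/b` gives a nonzerodivisor `b = ya` of `R` in `P`, so `P` contracts to a maximal
ideal; integrality lifts maximality back. -/
theorem isMaximal_of_mem_of_isIntegral (hdim : ringKrullDim R = 1) (C : Subalgebra R Q)
    [Algebra.IsIntegral R C] {y : C} (hy : y ∈ C⁰) {P : Ideal C} (hP : P.IsPrime) (hyP : y ∈ P) :
    P.IsMaximal := by
  obtain ⟨u, hu⟩ := isUnit_coe_of_mem_nonZeroDivisors hy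
  obtain ⟨⟨a, b⟩, hab⟩ := IsLocalization.surj R⁰ ((u⁻¹ : Qˣ) : Q)
  have hb : algebraMap R C b = y * algebraMap R C a := by
    apply Subtype.ext
    change algebraMap R Q b = (y : Q) * algebraMap R Q a
    rw [← hab, ← hu, ← mul_assoc, Units.mul_inv, one_mul]
  have := isMaximal_of_mem_of_ringKrullDim_eq_one hdim (Ideal.comap_isPrime (algebraMap R C) P)
    b.2 (by rw [Ideal.mem_comap, hb]; exact P.mul_mem_right _ hyP)
  exact Ideal.isMaximal_of_isIntegral_of_isMaximal_comap P this

end Dimension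

/-! ### Stable rings are quadratic -/

section StableToQuadratic

variable {R Q : Type*} [CommRing R] [CommRing Q] [Algebra R Q]

/-- Cayley–Hamilton for multiplication on `I`; evaluating at `1 ∈ I` recovers the relation in `Q`.
-/
theorem isIntegral_endRing {I : Submodule R Q} (hI : I.FG) (h1 : (1 : Q) ∈ I) :
    Algebra.IsIntegral R (endRing I) := by
  have : Module.Finite R I := Module.Finite.iff_fg.2 hI
  refine ⟨fun e => ?_⟩
  let φ : endRing I →ₐ[R] Module.End R I :=
    AlgHom.ofLinearMap
      { toFun := fun e => ((LinearMap.mulLeft R (e : Q)).restrict e.2 : I →ₗ[R] I)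
        map_add' := fun _ _ => LinearMap.ext fun _ => Subtype.ext (add_mul _ _ _)
        map_smul' := fun _ _ => LinearMap.ext fun _ => Subtype.ext (smul_mul_assoc _ _ _) }
      (LinearMap.ext fun _ => Subtype.ext (one_mul _))
      (fun _ _ => LinearMap.ext fun _ => Subtype.ext (mul_assoc _ _ _))
  obtain ⟨p, hp, hpe⟩ := LinearMap.exists_monic_and_aeval_eq_zero R (φ e)
  refine ⟨p, hp, ?_⟩
  rw [← Polynomial.aeval_def]
  have h2 : φ (Polynomial.aeval e p) = 0 := by rw [← hpe, Polynomial.aeval_algHom_apply]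
  have h3 := congrArg Subtype.val (LinearMap.congr_fun h2 ⟨1, h1⟩)
  apply Subtype.ext
  have h4 : ((Polynomial.aeval e p : endRing I) : Q) * 1 = 0 := h3
  simpa using h4

variable [IsFractionRing R Q] [IsLocalRing R]

/-- Every ring in the tower is a fractional ideal of `R`. -/
theorem exists_forall_tower_mul_mem (hreg : IsRegularIdeal (maximalIdeal R)) (n : ℕ) :
    ∃ d ∈ R⁰, d ∈ maximalIdeal R ∧
      ∀ q ∈ tower R Q n, ∃ r, algebraMap R Q d * q = algebraMap R Q r := by
  induction n with
  | zero =>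
    obtain ⟨d, hd, hdr⟩ := hreg
    refine ⟨d, hdr, hd, fun q hq => ?_⟩
    obtain ⟨r, rfl⟩ := Algebra.mem_bot.1 hq
    exact ⟨d * r, (map_mul _ _ _).symm⟩
  | succ n ih =>
    obtain ⟨d, hdr, hd, h⟩ := ih
    -- For `y` in the ring, `d²y = d(dy)` lies in `M`, so `d²y + 1` is already invertible in `R`.
    have hjac : algebraMap R Q (d * d) ∈ jac (tower R Q n) := by
      refine mem_jac_iff.2 ⟨Subalgebra.algebraMap_mem _ _, fun y hy => ?_⟩
      obtain ⟨r, hr⟩ := h y hy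
      have hb := (mem_jac_bot_iff (Q := Q)).2 ⟨d, hd, rfl⟩
      obtain ⟨z, hz, hz'⟩ := (mem_jac_iff.1 hb).2 (algebraMap R Q r) (Algebra.mem_bot.2 ⟨r, rfl⟩)
      refine ⟨z, tower_monotone R Q (Nat.zero_le n) hz, ?_⟩
      rw [map_mul, mul_assoc, hr]
      exact hz'
    refine ⟨d * (d * d), mul_mem hdr (mul_mem hdr hdr), Ideal.mul_mem_right _ _ hd,
      fun q hq => ?_⟩
    obtain ⟨r, hr⟩ := h _ (mem_of_mem_jac (hq _ hjac))
    exact ⟨r, by rw [← hr, map_mul]; ring⟩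

/-- Invertibility gives `pᵥ` with `pᵥI ⊆ E(I)` and `∑ pᵥxᵥ = 1`, `xᵥ ∈ I`. If the `pᵥ` generate the
unit ideal `A` of `E(I)`, then `I ⊆ E(I)`. Otherwise `A` lies in a maximal ideal while `d` lies in
every power of `A`, against `exists_notMem_pow_of_fg`. -/
theorem IsStableRing.le_endRing (hR : IsStableRing R) (hdim : ringKrullDim R = 1)
    (hreg : IsRegularIdeal (maximalIdeal R)) {n : ℕ} {I : Submodule R Q} (hI : I.FG)
    (h1 : (1 : Q) ∈ I) (hn : ∀ x ∈ I, x ∈ tower R Q n) : ∀ x ∈ I, x ∈ endRing I := by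
  classical
  obtain ⟨d, hdr, hdM, hd⟩ := exists_forall_tower_mul_mem (Q := Q) hreg n
  have hdu : IsUnit (algebraMap R Q d) := isUnit_algebraMap hdr
  -- Since `d` carries `Rₙ` into `R`, this is `dI`, a regular ideal to which stability applies.
  let I' : Ideal R := Submodule.comap (Algebra.linearMap R Q)
    (I.map (LinearMap.mulLeft R (algebraMap R Q d)))
  have memI' (r : R) : r ∈ I' ↔ ∃ x ∈ I, algebraMap R Q d * x = algebraMap R Q r := by
    simp [I', Submodule.mem_map]
  have hI' : IsRegularIdeal I' := ⟨d, (memI' d).2 ⟨1, h1, mul_one _⟩, hdr⟩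
  obtain ⟨s, q, hsum, hq⟩ := (hR I' hI').exists_sum_eq_one (Q := Q) hI'
  choose x hxI hx using fun v : I' => (memI' v).1 v.2
  let p : I' → Q := fun v => q v * algebraMap R Q d
  have hpI (v : I') {y : Q} (hy : y ∈ I) : p v * y ∈ endRing I := by
    intro z hz
    obtain ⟨a, ha⟩ := hd y (hn y hy)
    obtain ⟨b, hb⟩ := hd z (hn z hz)
    obtain ⟨c, hc, hc'⟩ := hq v a ((memI' a).2 ⟨y, hy, ha⟩) b ((memI' b).2 ⟨z, hz, hb⟩)
    obtain ⟨w, hw, hw'⟩ := (memI' c).1 hc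
    have : p v * y * z = w := by
      apply hdu.mul_left_cancel
      rw [hw', ← hc', ← ha, ← hb]
      ring
    rwa [this]
  have hpE (v : I') : p v ∈ endRing I := by simpa using hpI v h1
  have hsum' : ∑ v ∈ s, p v * x v = 1 := by
    rw [← hsum]
    refine Finset.sum_congr rfl fun v _ => ?_
    rw [← hx]
    ring
  let pE : I' → endRing I := fun v => ⟨p v, hpE v⟩
  let A : Ideal (endRing I) := Ideal.span (pE '' s)
  let J : Ideal (endRing I) :=
    { carrier := {e | ∀ y ∈ I, (e : Q) * y ∈ endRing I}
      zero_mem' := fun y _ => by simp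
      add_mem' := fun {a b} ha hb y hy => by
        rw [Subalgebra.coe_add, add_mul]
        exact add_mem (ha y hy) (hb y hy)
      smul_mem' := fun c e he y hy => by
        rw [smul_eq_mul, Subalgebra.coe_mul, mul_assoc]
        exact mul_mem c.2 (he y hy) }
  have hAJ : A ≤ J := by
    refine Ideal.span_le.2 ?_
    rintro _ ⟨v, -, rfl⟩
    exact fun y hy => hpI v hy
  by_cases hA : A = ⊤
  · have h2 : (1 : endRing I) ∈ J := hAJ (hA ▸ Submodule.mem_top)
    intro y hy
    simpa using h2 y hy
  · exfalso
    have := isIntegral_endRing hI h1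
    obtain ⟨P, hP, hAP⟩ := Ideal.exists_le_maximal A hA
    have hdE : algebraMap R (endRing I) d ∈ (endRing I)⁰ := mem_nonZeroDivisors_of_isUnit_coe hdu
    obtain ⟨k, hk⟩ := exists_notMem_pow_of_fg hdE
      (fun P' hP' h => isMaximal_of_mem_of_isIntegral hdim _ hdE hP' h) hP.isPrime
      ((algebraMap_mem_iff_of_isIntegral hP).2 hdM)
      (Submodule.fg_span (s.finite_toSet.image pE)) hAP
    refine hk ?_
    -- That is, `dRₙ ⊆ Aᵏ`: each step rewrites `dy` as `∑ pᵥ · d(xᵥy)`, with `xᵥy` still in `Rₙ`.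
    have key : ∀ k : ℕ, ∀ y ∈ tower R Q n, ∃ e ∈ A ^ k, (e : Q) = algebraMap R Q d * y := by
      intro k
      induction k with
      | zero =>
        intro y hy
        obtain ⟨r, hr⟩ := hd y hy
        exact ⟨algebraMap R _ r, by simp, hr.symm⟩
      | succ k ih =>
        intro y hy
        choose e he he' using fun v : I' => ih (x v * y) (mul_mem (hn _ (hxI v)) hy)
        refine ⟨∑ v ∈ s, pE v * e v, sum_mem fun v hv => ?_, ?_⟩
        · rw [pow_succ']
          exact Ideal.mul_mem_mul (Ideal.subset_span ⟨v, hv, rfl⟩) (he v)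
        · rw [AddSubmonoidClass.coe_finsetSum]
          have h3 : ∀ v ∈ s, ((pE v * e v : endRing I) : Q) =
              p v * x v * (algebraMap R Q d * y) := by
            intro v _
            rw [Subalgebra.coe_mul, he']
            ring
          rw [Finset.sum_congr rfl h3, ← Finset.sum_mul, hsum', one_mul]
    obtain ⟨e, he, he'⟩ := key k 1 (one_mem _)
    have : e = algebraMap R (endRing I) d := Subtype.ext (by rw [he', mul_one]; rfl)
    exact this ▸ he

theorem IsStableRing.isQuadraticRing (hR : IsStableRing R) (hdim : ringKrullDim R = 1)
    (hreg : IsRegularIdeal (maximalIdeal R)) : IsQuadraticRing R Q where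
  isQuadraticExtension := by
    intro x y
    obtain ⟨m, hm⟩ := mem_towerTop.1 x.2
    obtain ⟨n, hn⟩ := mem_towerTop.1 y.2
    have hx := tower_monotone R Q (le_max_left m n) hm
    have hy := tower_monotone R Q (le_max_right m n) hn
    let I : Submodule R Q := Submodule.span R {(x : Q), (y : Q), 1}
    have hxI : (x : Q) ∈ I := Submodule.subset_span (by simp)
    have hyI : (y : Q) ∈ I := Submodule.subset_span (by simp)
    have h1I : (1 : Q) ∈ I := Submodule.subset_span (by simp)
    have hle : I ≤ Subalgebra.toSubmodule (tower R Q (max m n)) := by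
      refine Submodule.span_le.2 ?_
      rintro z (rfl | rfl | rfl)
      · exact hx
      · exact hy
      · exact one_mem (tower R Q (max m n))
    have h := hR.le_endRing hdim hreg (Submodule.fg_span (Set.toFinite _)) h1I
      (fun z hz => hle hz) x hxI y hyI
    obtain ⟨a, b, c, habc⟩ := Submodule.mem_span_triple.1 h
    exact Submodule.mem_span_triple.2 ⟨a, b, c, Subtype.ext habc⟩
  isStableIdeal := hR _ hreg
  isRegularIdeal := hreg

end StableToQuadratic

/-! ### From three residue fields `𝔽₂` to a quadratic ring -/

section DedekindToQuadratic

/-- If a ring has three maximal ideals, each with residue field of two elements, then the function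
`x y` on it agrees with an affine function modulo the Jacobson radical. -/
theorem mem_jacobson_of_setOf_isMaximal_eq {S : Type*} [CommRing S] {P₁ P₂ P₃ : Ideal S}
    (hmax : {P : Ideal S | P.IsMaximal} = {P₁, P₂, P₃})
    (h : ∀ P : Ideal S, P.IsMaximal → ∀ z : S, z ∈ P ∨ z - 1 ∈ P) (x y : S) :
    x * y ∈ Ideal.jacobson (⊥ : Ideal S) ∨ x * (y - 1) ∈ Ideal.jacobson (⊥ : Ideal S) ∨
      (x - 1) * y ∈ Ideal.jacobson (⊥ : Ideal S) ∨
      (x - 1) * (y - 1) ∈ Ideal.jacobson (⊥ : Ideal S) := by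
  have hmem (P : Ideal S) : P.IsMaximal ↔ P = P₁ ∨ P = P₂ ∨ P = P₃ := by
    have := Set.ext_iff.1 hmax P
    simpa using this
  have hjac (z : S) (h₁ : z ∈ P₁) (h₂ : z ∈ P₂) (h₃ : z ∈ P₃) :
      z ∈ Ideal.jacobson (⊥ : Ideal S) := by
    refine Submodule.mem_sInf.2 fun P hP => ?_
    rcases (hmem P).1 hP.2 with rfl | rfl | rfl <;> assumption
  -- Each maximal ideal misses at most one of the four products, so three of them leave some product
  -- in all.
  have key (P : Ideal S) (hP : P.IsMaximal) :
      (x * y ∈ P ∧ x * (y - 1) ∈ P ∧ (x - 1) * y ∈ P) ∨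
      (x * y ∈ P ∧ x * (y - 1) ∈ P ∧ (x - 1) * (y - 1) ∈ P) ∨
      (x * y ∈ P ∧ (x - 1) * y ∈ P ∧ (x - 1) * (y - 1) ∈ P) ∨
      (x * (y - 1) ∈ P ∧ (x - 1) * y ∈ P ∧ (x - 1) * (y - 1) ∈ P) := by
    rcases h P hP x with hx | hx <;> rcases h P hP y with hy | hy
    · exact .inl ⟨P.mul_mem_right _ hx, P.mul_mem_right _ hx, P.mul_mem_left _ hy⟩
    · exact .inr (.inl ⟨P.mul_mem_right _ hx, P.mul_mem_right _ hx, P.mul_mem_left _ hy⟩)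
    · exact .inr (.inr (.inl ⟨P.mul_mem_left _ hy, P.mul_mem_left _ hy, P.mul_mem_right _ hx⟩))
    · exact .inr (.inr (.inr ⟨P.mul_mem_left _ hy, P.mul_mem_right _ hx, P.mul_mem_right _ hx⟩))
  have k₁ := key P₁ ((hmem P₁).2 (by simp))
  have k₂ := key P₂ ((hmem P₂).2 (by simp))
  have k₃ := key P₃ ((hmem P₃).2 (by simp))
  have j₁ := hjac (x * y)
  have j₂ := hjac (x * (y - 1))
  have j₃ := hjac ((x - 1) * y)
  have j₄ := hjac ((x - 1) * (y - 1))
  clear key hjac hmem h hmax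
  generalize x * y = a at *
  generalize x * (y - 1) = b at *
  generalize (x - 1) * y = c at *
  generalize (x - 1) * (y - 1) = d at *
  rcases k₁ with ⟨_, _, _⟩ | ⟨_, _, _⟩ | ⟨_, _, _⟩ | ⟨_, _, _⟩ <;>
  rcases k₂ with ⟨_, _, _⟩ | ⟨_, _, _⟩ | ⟨_, _, _⟩ | ⟨_, _, _⟩ <;>
  rcases k₃ with ⟨_, _, _⟩ | ⟨_, _, _⟩ | ⟨_, _, _⟩ | ⟨_, _, _⟩ <;>
  first
    | exact .inl (j₁ ‹_› ‹_› ‹_›)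
    | exact .inr (.inl (j₂ ‹_› ‹_› ‹_›))
    | exact .inr (.inr (.inl (j₃ ‹_› ‹_› ‹_›)))
    | exact .inr (.inr (.inr (j₄ ‹_› ‹_› ‹_›)))

variable {R Q : Type*} [CommRing R] [CommRing Q] [Algebra R Q] [IsFractionRing R Q]
  [IsLocalRing R]

theorem isQuadraticRing_of_isDedekind (hreg : IsRegularIdeal (maximalIdeal R))
    {S : Subalgebra R Q} (hS : IsDedekindWithZeroDivisors S)
    (hcard : {N : Ideal S | N.IsMaximal}.ncard = 3)
    (hres : ∀ N : Ideal S, N.IsMaximal → Nonempty (S ⧸ N ≃+* ZMod 2))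
    (hrange : Set.range (algebraMap R Q) =
      algebraMap R Q '' ((⊥ : Subring R) : Set R) + (jac S : Set Q)) : IsQuadraticRing R Q := by
  have hinj := IsFractionRing.injective R Q
  have hfin : {N : Ideal S | N.IsMaximal}.Finite := Set.finite_of_ncard_ne_zero (by omega)
  obtain ⟨P₁, P₂, P₃, -, -, -, hP⟩ := Set.ncard_eq_three.1 hcard
  have h₁ : P₁.IsMaximal := by
    have : P₁ ∈ {N : Ideal S | N.IsMaximal} := by rw [hP]; simp
    exact this
  have hres' : ∀ P : Ideal S, P.IsMaximal → ∀ z : S, z ∈ P ∨ z - 1 ∈ P := fun P hP z =>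
    mem_or_sub_one_mem_of_ringEquiv_zmod_two (hres P hP).some z
  have one_notMem : (1 : Q) ∉ jac S := by
    rintro ⟨x, hx, hx1⟩
    have : x = 1 := Subtype.ext hx1
    exact h₁.ne_top ((Ideal.eq_top_iff_one _).2 (this ▸ jacobson_bot_le_of_isMaximal h₁ hx))
  have jac_sub {q : Q} (hq : q ∈ jac S) : ∃ r ∈ maximalIdeal R, algebraMap R Q r = q := by
    have : q ∈ Set.range (algebraMap R Q) := by
      rw [hrange]
      exact ⟨0, ⟨0, zero_mem _, map_zero _⟩, q, hq, zero_add q⟩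
    obtain ⟨r, rfl⟩ := this
    refine ⟨r, (mem_maximalIdeal r).2 fun hr => one_notMem ?_, rfl⟩
    obtain ⟨s, hs⟩ := isUnit_iff_exists_inv.1 hr
    have := mul_mem_jac (S.algebraMap_mem s) hq
    rwa [← map_mul, mul_comm, hs, map_one] at this
  have two_mem : (2 : Q) ∈ jac S := by
    refine ⟨2, Submodule.mem_sInf.2 fun P hP => ?_, rfl⟩
    rcases hres' P hP.2 2 with h | h
    · exact h
    · refine absurd ((Ideal.eq_top_iff_one P).2 ?_) hP.2.ne_top
      convert h using 1
      norm_num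
  have two_mem' : (2 : R) ∈ maximalIdeal R := by
    obtain ⟨r, hr, hr2⟩ := jac_sub two_mem
    have : r = 2 := hinj (by rw [hr2, map_ofNat])
    exact this ▸ hr
  have sub_jac {r : R} (hr : r ∈ maximalIdeal R) : algebraMap R Q r ∈ jac S := by
    have : algebraMap R Q r ∈ Set.range (algebraMap R Q) := ⟨r, rfl⟩
    rw [hrange] at this
    obtain ⟨_, ⟨n, hn, rfl⟩, q, hq, hrq⟩ := this
    obtain ⟨m, rfl⟩ := Subring.mem_bot.1 hn
    obtain ⟨r', hr', rfl⟩ := jac_sub hq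
    have hm : r - r' = (m : R) := by
      apply hinj
      rw [map_sub, ← hrq]
      simp
    have hmM : (m : R) ∈ maximalIdeal R := hm ▸ Ideal.sub_mem _ hr hr'
    -- Since `2 ∈ Jac S`, an even integer part is absorbed in the radical; an odd one would put `1`
    -- in `M`. Hence `M = Jac S`.
    rcases Int.even_or_odd' m with ⟨k, rfl | rfl⟩
    · rw [← hrq]
      refine add_mem ?_ hq
      rw [map_intCast, Int.cast_mul, mul_comm]
      exact mul_mem_jac (intCast_mem S k) (by simpa using two_mem)
    · exfalso
      have h2 : (1 : R) ∈ maximalIdeal R := by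
        have := Ideal.sub_mem _ hmM (Ideal.mul_mem_right (k : R) _ two_mem')
        push_cast at this
        rwa [add_sub_cancel_left] at this
      exact (mem_maximalIdeal (1 : R)).1 h2 isUnit_one
  have hJreg : IsRegularIdeal (Ideal.jacobson (⊥ : Ideal S)) := by
    obtain ⟨d, hd, hdr⟩ := hreg
    exact ⟨algebraMap R S d, coe_mem_jac.1 (sub_jac hd),
      mem_nonZeroDivisors_of_isUnit_coe (isUnit_algebraMap hdr)⟩
  obtain ⟨j, hj, hjac⟩ := hS.exists_eq_span hfin hJreg
  have hju := isUnit_coe_of_mem_nonZeroDivisors hj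
  have hjac' (q : Q) : q ∈ jac S ↔ ∃ c ∈ S, q = j * c := by
    rw [mem_jac, hjac]
    constructor
    · rintro ⟨x, hx, rfl⟩
      obtain ⟨c, rfl⟩ := Ideal.mem_span_singleton.1 hx
      exact ⟨c, c.2, rfl⟩
    · rintro ⟨c, hc, rfl⟩
      exact ⟨j * ⟨c, hc⟩, Ideal.mem_span_singleton.2 (dvd_mul_right _ _), rfl⟩
  have hjac0 : jac (tower R Q 0) = jac S := by
    ext q
    rw [tower_zero, mem_jac_bot_iff]
    refine ⟨?_, jac_sub⟩
    rintro ⟨r, hr, rfl⟩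
    exact sub_jac hr
  have htower1 : tower R Q 1 = S := by
    rw [tower_succ, hjac0, endRing_jac_eq hju hjac']
  have htop : towerTop R Q = S := by
    rw [towerTop_eq_of_endRing_eq (n := 1), htower1]
    rw [htower1, endRing_jac_eq hju hjac']
  refine ⟨?_, ?_, hreg⟩
  · rw [htop]
    intro x y
    have hmem {z : S} (hz : z ∈ Ideal.jacobson (⊥ : Ideal S)) : ∃ r, algebraMap R S r = z := by
      obtain ⟨r, -, hr⟩ := jac_sub (coe_mem_jac.2 hz)
      exact ⟨r, Subtype.ext hr⟩
    rcases mem_jacobson_of_setOf_isMaximal_eq hP hres' x y with h | h | h | h <;>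
      obtain ⟨r, hr⟩ := hmem h <;> refine Submodule.mem_span_triple.2 ?_
    · exact ⟨0, 0, r, by simp [Algebra.smul_def, hr]⟩
    · exact ⟨1, 0, r, by simp only [Algebra.smul_def, hr, map_one, map_zero]; ring⟩
    · exact ⟨0, 1, r, by simp only [Algebra.smul_def, hr, map_one, map_zero]; ring⟩
    · exact ⟨1, 1, r - 1, by simp only [Algebra.smul_def, map_sub, hr, map_one]; ring⟩
  · obtain ⟨i, hi, hij⟩ := jac_sub ((hjac' j).2 ⟨1, one_mem S, by ring⟩)
    refine isStableIdeal_of_forall_mul hi ?_ fun a ha b hb => ?_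
    · rw [mem_nonZeroDivisors_iff_right]
      intro t ht
      apply hinj
      apply hju.mul_right_cancel
      rw [← hij, ← map_mul, ht, map_zero, zero_mul]
    · obtain ⟨s, hs, has⟩ := (hjac' _).1 (sub_jac ha)
      obtain ⟨t, ht, hbt⟩ := (hjac' _).1 (sub_jac hb)
      obtain ⟨c, hc, hc'⟩ := jac_sub ((hjac' (j * (s * t))).2 ⟨_, mul_mem hs ht, rfl⟩)
      refine ⟨c, hc, hinj ?_⟩
      rw [map_mul, map_mul, has, hbt, hc', hij]
      ring

end DedekindToQuadratic

/-! ### The tower of a quadratic ring -/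

section QuadraticTower

variable {R Q : Type*} [CommRing R] [CommRing Q] [Algebra R Q] [IsFractionRing R Q]
  [IsLocalRing R]

/-- The maximal ideal of a quadratic ring is a principal ideal of its endomorphism ring. -/
theorem IsQuadraticRing.exists_generator (hR : IsQuadraticRing R Q) :
    ∃ m ∈ maximalIdeal R, IsUnit (algebraMap R Q m) ∧
      ∀ q, q ∈ jac (tower R Q 0) ↔ ∃ c ∈ tower R Q 1, q = algebraMap R Q m * c := by
  classical
  set C := tower R Q 1
  have := isFractionRing_subalgebra (Q := Q) C
  have hq : IsQuadraticExtension R C :=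
    hR.isQuadraticExtension.of_le (tower_le_towerTop R Q 1)
  obtain ⟨s, p, hsum, hp⟩ := hR.isStableIdeal.exists_sum_eq_one (Q := Q) hR.isRegularIdeal
  have mem0 {q : Q} : q ∈ jac (tower R Q 0) ↔ ∃ r ∈ maximalIdeal R, algebraMap R Q r = q :=
    mem_jac_bot_iff
  let I : Ideal C :=
    { carrier := {c | (c : Q) ∈ jac (tower R Q 0)}
      zero_mem' := zero_mem (jac (tower R Q 0))
      add_mem' := fun ha hb => (jac (tower R Q 0)).add_mem ha hb
      smul_mem' := fun c x hx => c.2 _ hx }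
  have memI {c : C} : c ∈ I ↔ (c : Q) ∈ jac (tower R Q 0) := Iff.rfl
  -- The inverse of `M` over `C = E(M)`. As `C` is quadratic over `R`, it has finitely many maximal
  -- ideals, so the invertible ideal `M` is principal over it.
  let I' : FractionalIdeal C⁰ Q :=
    ⟨Submodule.span C (p '' s), FractionalIdeal.isFractional_of_fg
      (Submodule.fg_span (s.finite_toSet.image p))⟩
  have hinv : (I : FractionalIdeal C⁰ Q) * I' = 1 := by
    apply le_antisymm
    · refine FractionalIdeal.mul_le.2 fun x hx y hy => ?_
      obtain ⟨c, hc, rfl⟩ := (FractionalIdeal.mem_coeIdeal C⁰).1 hx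
      have hy' : y ∈ Submodule.span C (p '' s) := hy
      clear hy
      induction hy' using Submodule.span_induction with
      | mem y hy =>
        obtain ⟨v, -, rfl⟩ := hy
        refine (FractionalIdeal.mem_one_iff C⁰).2 ⟨⟨p v * c, ?_⟩, mul_comm _ _⟩
        intro z hz
        obtain ⟨a, ha, ha'⟩ := mem0.1 (memI.1 hc)
        obtain ⟨b, hb, rfl⟩ := mem0.1 hz
        obtain ⟨d, hd, hd'⟩ := hp v a ha b hb
        rw [← ha', hd']
        exact mem0.2 ⟨d, hd, rfl⟩
      | zero => rw [mul_zero]; exact zero_mem ((1 : FractionalIdeal C⁰ Q) : Submodule C Q)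
      | add y z _ _ hy hz => rw [mul_add]; exact add_mem (S := Submodule C Q) hy hz
      | smul c y _ hy => rw [mul_smul_comm]; exact Submodule.smul_mem ((1 : FractionalIdeal C⁰ Q) : Submodule C Q) _ hy
    · rw [FractionalIdeal.one_le, ← hsum]
      refine Submodule.sum_mem (((I : FractionalIdeal C⁰ Q) * I' : FractionalIdeal C⁰ Q) :
        Submodule C Q) fun v hv => ?_
      rw [mul_comm (p v), FractionalIdeal.mem_coe]
      refine FractionalIdeal.mul_mem_mul (J := I') ?_
        (show p v ∈ Submodule.span C (p '' s) from Submodule.subset_span ⟨v, hv, rfl⟩)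
      exact (FractionalIdeal.mem_coeIdeal C⁰).2
        ⟨algebraMap R C v, memI.2 (mem0.2 ⟨v, v.2, rfl⟩), rfl⟩
  have hprin := FractionalIdeal.isPrincipal.of_finite_maximals_of_inv le_rfl hq.finite_isMaximal
    _ _ hinv
  obtain ⟨g, hg⟩ := hprin.principal
  have memg {q : Q} : q ∈ jac (tower R Q 0) ↔ ∃ c : C, c • g = q := by
    rw [← Submodule.mem_span_singleton, ← hg, FractionalIdeal.mem_coe,
      FractionalIdeal.mem_coeIdeal]
    constructor
    · intro h
      obtain ⟨r, hr, rfl⟩ := mem0.1 h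
      exact ⟨algebraMap R C r, memI.2 h, rfl⟩
    · rintro ⟨c, hc, rfl⟩
      exact memI.1 hc
  obtain ⟨m, hm, hmg⟩ := mem0.1 (memg.2 ⟨1, one_smul _ _⟩)
  refine ⟨m, hm, ?_, fun q => memg.trans ⟨?_, ?_⟩⟩
  · obtain ⟨d, hd, hdr⟩ := hR.isRegularIdeal
    obtain ⟨c, hc⟩ := memg.1 (mem0.2 ⟨d, hd, rfl⟩)
    have hu : IsUnit (algebraMap R Q d) := isUnit_algebraMap hdr
    rw [← hc, ← hmg] at hu
    exact isUnit_of_mul_isUnit_right (x := (c : Q)) hu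
  · rintro ⟨c, rfl⟩
    exact ⟨c, c.2, by rw [hmg, mul_comm]; rfl⟩
  · rintro ⟨c, hc, rfl⟩
    exact ⟨⟨c, hc⟩, by rw [hmg, mul_comm]; rfl⟩

theorem map_maximalIdeal_eq_span {m : R} (hm : m ∈ maximalIdeal R)
    (hgen : ∀ q, q ∈ jac (tower R Q 0) ↔ ∃ c ∈ tower R Q 1, q = algebraMap R Q m * c)
    {C : Subalgebra R Q} (hC : tower R Q 1 ≤ C) :
    (maximalIdeal R).map (algebraMap R C) = Ideal.span {algebraMap R C m} := by
  apply le_antisymm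
  · refine Ideal.map_le_iff_le_comap.2 fun r hr => ?_
    obtain ⟨c, hc, hrc⟩ := (hgen _).1 (mem_jac_bot_iff.2 ⟨r, hr, rfl⟩)
    exact Ideal.mem_span_singleton.2 ⟨⟨c, hC hc⟩, Subtype.ext hrc⟩
  · rw [Ideal.span_singleton_le_iff_mem]
    exact Ideal.mem_map_of_mem _ hm

theorem isLocalRing_or_exists_ne (C : Type*) [CommRing C] [Nontrivial C] :
    IsLocalRing C ∨ ∃ P₁ P₂ : Ideal C, P₁.IsMaximal ∧ P₂.IsMaximal ∧ P₁ ≠ P₂ := by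
  obtain ⟨P₁, h₁⟩ := Ideal.exists_maximal C
  by_cases h : ∃ P₂ : Ideal C, P₂.IsMaximal ∧ P₁ ≠ P₂
  · obtain ⟨P₂, h₂, hne⟩ := h
    exact .inr ⟨P₁, P₂, h₁, h₂, hne⟩
  · push Not at h
    exact .inl (IsLocalRing.of_unique_max_ideal ⟨P₁, h₁, fun P hP => (h P hP).symm⟩)

theorem jac_principal_or_isLocalRing {m : R} (hm : m ∈ maximalIdeal R)
    (hmu : IsUnit (algebraMap R Q m)) {C : Subalgebra R Q} (hq : IsQuadraticExtension R C)
    (hspan : (maximalIdeal R).map (algebraMap R C) = Ideal.span {algebraMap R C m}) :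
    (∃ j, IsUnit j ∧ ∀ q, q ∈ jac C ↔ ∃ c ∈ C, q = j * c) ∨
      (IsLocalRing C ∧ ∀ q, q ∈ jac C ↔ ∃ c ∈ endRing (jac C), q = algebraMap R Q m * c) := by
  have hinj := IsFractionRing.injective R Q
  have := hq.isIntegral
  have : Nontrivial Q := hinj.nontrivial
  have mem_span {x : C} : x ∈ (maximalIdeal R).map (algebraMap R C) ↔
      ∃ c ∈ C, (x : Q) = algebraMap R Q m * c := by
    rw [hspan, Ideal.mem_span_singleton]
    exact ⟨fun ⟨c, hc⟩ => ⟨c, c.2, congrArg Subtype.val hc⟩,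
      fun ⟨c, hc, h⟩ => ⟨⟨c, hc⟩, Subtype.ext h⟩⟩
  rcases isLocalRing_or_exists_ne C with hloc | ⟨P₁, P₂, h₁, h₂, hne⟩
  -- Here `(Jac C)² ⊆ mC`. If some `xy` is `m` times a unit, `y` generates: for `z ∈ Jac C`, `xz ∈
  -- mC = xyC`, and `x` cancels. Otherwise `(Jac C)² ⊆ m Jac C`, so `m⁻¹ Jac C ⊆ E(Jac C)`.
  · by_cases h : ∃ x ∈ jac C, ∃ y ∈ jac C, ∃ u ∈ C, u ∉ jac C ∧ x * y = algebraMap R Q m * u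
    · obtain ⟨x, hx, y, hy, u, hu, huj, hxy⟩ := h
      have hunit : IsUnit (⟨u, hu⟩ : C) := by
        by_contra hn
        refine huj (coe_mem_jac (x := ⟨u, hu⟩) |>.2 ?_)
        rw [IsLocalRing.jacobson_eq_maximalIdeal ⊥ bot_ne_top]
        exact (mem_maximalIdeal _).2 hn
      obtain ⟨w, hw⟩ := isUnit_iff_exists_inv.1 hunit
      have hw' : u * (w : Q) = 1 := congrArg Subtype.val hw
      have hm' : algebraMap R Q m = x * (y * w) := by
        linear_combination -algebraMap R Q m * hw' - (w : Q) * hxy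
      have hxu : IsUnit x := isUnit_of_mul_isUnit_left (hm' ▸ hmu)
      have hyu : IsUnit y :=
        isUnit_of_mul_isUnit_left (isUnit_of_mul_isUnit_right (hm' ▸ hmu))
      refine .inl ⟨y, hyu, fun z => ⟨fun hz => ?_, ?_⟩⟩
      · obtain ⟨x', hx', hx''⟩ := mem_jac.1 hx
        obtain ⟨z', hz', hz''⟩ := mem_jac.1 hz
        obtain ⟨c, hc, hc'⟩ := mem_span.1 (hq.mul_mem_of_mem_jacobson hx' hz')
        refine ⟨w * c, mul_mem w.2 hc, hxu.mul_left_cancel ?_⟩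
        change (x' : Q) * z' = _ at hc'
        rw [hx'', hz''] at hc'
        rw [hc', hm']
        ring
      · rintro ⟨c, hc, rfl⟩
        rw [mul_comm]
        exact mul_mem_jac hc hy
    · push Not at h
      refine .inr ⟨hloc, fun z => ⟨fun hz => ?_, ?_⟩⟩
      · obtain ⟨w, hw⟩ := isUnit_iff_exists_inv.1 hmu
        refine ⟨w * z, fun x hx => ?_, by rw [← mul_assoc, hw, one_mul]⟩
        obtain ⟨x', hx', hx''⟩ := mem_jac.1 hx
        obtain ⟨z', hz', hz''⟩ := mem_jac.1 hz
        obtain ⟨c, hc, hc'⟩ := mem_span.1 (hq.mul_mem_of_mem_jacobson hz' hx')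
        have hc'' : z * x = algebraMap R Q m * c := by rw [← hc', ← hx'', ← hz'']; rfl
        have : w * z * x = c := by linear_combination w * hc'' + c * hw
        rw [this]
        by_contra hcj
        exact h z hz x hx c hc hcj hc''
      · rintro ⟨c, hc, rfl⟩
        rw [mul_comm]
        exact hc _ (coe_mem_jac (x := algebraMap R C m) |>.2
          (map_maximalIdeal_le_jacobson (Ideal.mem_map_of_mem _ hm)))
  · refine .inl ⟨algebraMap R Q m, hmu, fun q => ⟨fun hqj => ?_, ?_⟩⟩
    · obtain ⟨x, hx, rfl⟩ := hqj
      rw [hq.jacobson_eq_of_ne h₁ h₂ hne] at hx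
      exact mem_span.1 hx
    · rintro ⟨c, hc, rfl⟩
      refine (coe_mem_jac (x := algebraMap R C m * ⟨c, hc⟩)).2 ?_
      rw [hq.jacobson_eq_of_ne h₁ h₂ hne]
      exact Ideal.mul_mem_right _ _ (Ideal.mem_map_of_mem _ hm)

theorem IsQuadraticRing.exists_jac_towerTop (hR : IsQuadraticRing R Q) :
    ∃ j, IsUnit j ∧ ∀ q, q ∈ jac (towerTop R Q) ↔ ∃ c ∈ towerTop R Q, q = j * c := by
  have hinj := IsFractionRing.injective R Q
  have : Nontrivial Q := hinj.nontrivial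
  obtain ⟨m, hm, hmu, hgen⟩ := hR.exists_generator
  by_cases h : ∃ n j, IsUnit j ∧ ∀ q, q ∈ jac (tower R Q (n + 1)) ↔
      ∃ c ∈ tower R Q (n + 1), q = j * c
  · obtain ⟨n, j, hj, hjac⟩ := h
    rw [towerTop_eq_of_endRing_eq (endRing_jac_eq hj hjac)]
    exact ⟨j, hj, hjac⟩
  · have step (n : ℕ) := (jac_principal_or_isLocalRing hm hmu
      (hR.isQuadraticExtension.of_le (tower_le_towerTop R Q (n + 1)))
      (map_maximalIdeal_eq_span hm hgen (tower_monotone R Q (Nat.le_add_left 1 n)))).resolve_left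
      fun ⟨j, hj⟩ => h ⟨n, j, hj⟩
    refine ⟨algebraMap R Q m, hmu, fun q => ⟨fun hq => ?_, ?_⟩⟩
    · obtain ⟨hqB, hunit⟩ := mem_jac_iff.1 hq
      obtain ⟨k, hk⟩ := mem_towerTop.1 hqB
      have hk' := tower_monotone R Q (Nat.le_succ k) hk
      have hloc := (step k).1
      have hqj : q ∈ jac (tower R Q (k + 1)) := by
        refine (coe_mem_jac (x := ⟨q, hk'⟩)).2 ?_
        rw [IsLocalRing.jacobson_eq_maximalIdeal ⊥ bot_ne_top]
        refine (mem_maximalIdeal _).2 fun hu => ?_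
        obtain ⟨w, hw⟩ := isUnit_iff_exists_inv.1 hu
        have hw' : q * (w : Q) = 1 := congrArg Subtype.val hw
        obtain ⟨z, -, hz⟩ := hunit (-w) (neg_mem (tower_le_towerTop R Q _ w.2))
        rw [mul_neg, hw', neg_add_cancel, zero_mul] at hz
        exact zero_ne_one hz
      obtain ⟨c, hc, rfl⟩ := ((step k).2 q).1 hqj
      exact ⟨c, tower_le_towerTop R Q (k + 2) hc, rfl⟩
    · rintro ⟨c, hc, rfl⟩
      refine mem_jac_iff.2 ⟨mul_mem (Subalgebra.algebraMap_mem _ _) hc, fun y hy => ?_⟩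
      obtain ⟨k, hk⟩ := mem_towerTop.1 (mul_mem hc hy)
      have hk' : c * y ∈ tower R Q (k + 2) := tower_monotone R Q (Nat.le_add_right k 2) hk
      obtain ⟨z, hz, hz'⟩ := (mem_jac_iff.1 (((step k).2 _).2 ⟨_, hk', rfl⟩)).2 1 (one_mem _)
      refine ⟨z, tower_le_towerTop R Q _ hz, ?_⟩
      rwa [mul_one, ← mul_assoc] at hz'

theorem IsQuadraticRing.exists_eq_span (hR : IsQuadraticRing R Q) (hdim : ringKrullDim R = 1)
    {K : Ideal (towerTop R Q)} (hK : IsRegularIdeal K) :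
    ∃ b ∈ (towerTop R Q)⁰, K = Ideal.span {b} := by
  have hq := hR.isQuadraticExtension
  have := hq.isIntegral
  obtain ⟨j, hj, hjac⟩ := hR.exists_jac_towerTop
  have hjm : j ∈ jac (towerTop R Q) := (hjac j).2 ⟨1, one_mem _, by ring⟩
  refine exists_eq_span_of_jacobson_eq hq.finite_isMaximal
    (j := ⟨j, mem_of_mem_jac hjm⟩) (mem_nonZeroDivisors_of_isUnit_coe hj) ?_
    (fun y hy P hP hyP => isMaximal_of_mem_of_isIntegral hdim _ hy hP hyP) hK
  ext x
  rw [← coe_mem_jac, hjac, Ideal.mem_span_singleton]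
  exact ⟨fun ⟨c, hc, h⟩ => ⟨⟨c, hc⟩, Subtype.ext h⟩,
    fun ⟨c, hc⟩ => ⟨c, c.2, congrArg Subtype.val hc⟩⟩

/-- Two maximal ideals can be avoided simultaneously by `i₁`, `i₂` or `i₁ + i₂`, whatever the
residue fields; this gives `i ∈ I` with `IB = iB`. Then for `a = is`, `a' = it` in `I`, the relation
`st = xs + yt + z` yields `aa' = i(xa + ya' + zi)`. -/
theorem IsQuadraticRing.isStableRing_of_forall_eq_or_eq (hR : IsQuadraticRing R Q)
    (hdim : ringKrullDim R = 1) {P₁ P₂ : Ideal (towerTop R Q)} (h₁ : P₁.IsMaximal)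
    (h₂ : P₂.IsMaximal) (hmax : ∀ P : Ideal (towerTop R Q), P.IsMaximal → P = P₁ ∨ P = P₂) :
    IsStableRing R := by
  intro I hI
  have hinj := IsFractionRing.injective R Q
  have hreg : IsRegularIdeal (I.map (algebraMap R (towerTop R Q))) := by
    obtain ⟨d, hd, hdr⟩ := hI
    exact ⟨algebraMap R (towerTop R Q) d, Ideal.mem_map_of_mem _ hd,
      mem_nonZeroDivisors_of_isUnit_coe (isUnit_algebraMap hdr)⟩
  obtain ⟨b, hb, hspan⟩ := hR.exists_eq_span hdim hreg
  have hdiv {i : R} (hi : i ∈ I) : ∃ v, algebraMap R (towerTop R Q) i = b * v := by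
    have := Ideal.mem_map_of_mem (algebraMap R (towerTop R Q)) hi
    rw [hspan] at this
    exact Ideal.mem_span_singleton.1 this
  have hex {P : Ideal (towerTop R Q)} (hP : P.IsMaximal) :
      ∃ i ∈ I, ∃ v, algebraMap R (towerTop R Q) i = b * v ∧ v ∉ P := by
    by_contra! hcon
    have hle : I.map (algebraMap R (towerTop R Q)) ≤ Ideal.span {b} * P := by
      refine Ideal.map_le_iff_le_comap.2 fun i hi => ?_
      obtain ⟨v, hv⟩ := hdiv hi
      rw [Ideal.mem_comap, hv]
      exact Ideal.mul_mem_mul (Ideal.mem_span_singleton_self b) (hcon i hi v hv)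
    have hbm : b ∈ Ideal.span {b} * P := hle (hspan ▸ Ideal.mem_span_singleton_self b)
    obtain ⟨v, hv, hbv⟩ := Ideal.mem_span_singleton_mul.1 hbm
    have : v = 1 := (mul_cancel_left_mem_nonZeroDivisors hb).1 (by rw [hbv, mul_one])
    exact hP.ne_top ((Ideal.eq_top_iff_one _).2 (this ▸ hv))
  obtain ⟨i, hi, v, hv, hvu⟩ : ∃ i ∈ I, ∃ v,
      algebraMap R (towerTop R Q) i = b * v ∧ v ∉ P₁ ∧ v ∉ P₂ := by
    obtain ⟨i₁, hi₁, v₁, hv₁, hn₁⟩ := hex h₁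
    obtain ⟨i₂, hi₂, v₂, hv₂, hn₂⟩ := hex h₂
    by_cases hc₁ : v₁ ∈ P₂
    · by_cases hc₂ : v₂ ∈ P₁
      · refine ⟨i₁ + i₂, I.add_mem hi₁ hi₂, v₁ + v₂, by rw [map_add, hv₁, hv₂, mul_add], ?_, ?_⟩
        · rwa [Ideal.add_mem_iff_left _ hc₂]
        · rwa [Ideal.add_mem_iff_right _ hc₁]
      · exact ⟨i₂, hi₂, v₂, hv₂, hc₂, hn₂⟩
    · exact ⟨i₁, hi₁, v₁, hv₁, hn₁, hc₁⟩
  have hvunit : IsUnit v := by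
    by_contra hn
    obtain ⟨P, hP, hvP⟩ := exists_max_ideal_of_mem_nonunits hn
    rcases hmax P hP with rfl | rfl
    · exact hvu.1 hvP
    · exact hvu.2 hvP
  obtain ⟨w, hw⟩ := isUnit_iff_exists_inv.1 hvunit
  have hdiv' {a : R} (ha : a ∈ I) : ∃ s,
      algebraMap R (towerTop R Q) a = algebraMap R (towerTop R Q) i * s := by
    obtain ⟨t, ht⟩ := hdiv ha
    exact ⟨w * t, by rw [ht, hv]; linear_combination -b * t * hw⟩
  have hinjB : Function.Injective (algebraMap R (towerTop R Q)) := fun x y hxy =>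
    hinj (congrArg (fun z : towerTop R Q => (z : Q)) hxy)
  refine isStableIdeal_of_forall_mul hi ?_ fun a ha a' ha' => ?_
  · rw [mem_nonZeroDivisors_iff_right]
    intro t ht
    apply hinjB
    have hbv : b * v ∈ (towerTop R Q)⁰ := mul_mem hb hvunit.mem_nonZeroDivisors
    rw [map_zero]
    apply mem_nonZeroDivisors_iff_right.1 hbv
    rw [← hv, ← map_mul, ht, map_zero]
  · obtain ⟨s, hs⟩ := hdiv' ha
    obtain ⟨t, ht⟩ := hdiv' ha'
    obtain ⟨x, y, z, h⟩ := hR.isQuadraticExtension.exists_mul_eq s t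
    refine ⟨x * a + y * a' + z * i, I.add_mem (I.add_mem (I.mul_mem_left _ ha)
      (I.mul_mem_left _ ha')) (I.mul_mem_left _ hi), hinjB ?_⟩
    simp only [map_mul, map_add]
    rw [hs, ht]
    linear_combination (algebraMap R (towerTop R Q) i) ^ 2 * h

/-- If `R_∞` has three maximal ideals, the tower stops at its first step. -/
theorem IsQuadraticRing.towerTop_eq (hR : IsQuadraticRing R Q) {m : R}
    (hm : m ∈ maximalIdeal R) (hmu : IsUnit (algebraMap R Q m))
    (hgen : ∀ q, q ∈ jac (tower R Q 0) ↔ ∃ c ∈ tower R Q 1, q = algebraMap R Q m * c)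
    {P₁ P₂ P₃ : Ideal (towerTop R Q)} (h₁ : P₁.IsMaximal) (h₂ : P₂.IsMaximal)
    (h₃ : P₃.IsMaximal) (h₁₂ : P₁ ≠ P₂) (h₁₃ : P₁ ≠ P₃) (h₂₃ : P₂ ≠ P₃) :
    towerTop R Q = tower R Q 1 := by
  have hq := hR.isQuadraticExtension
  have := hq.isIntegral
  have hq1 := hq.of_le (tower_le_towerTop R Q 1)
  have hspan1 := map_maximalIdeal_eq_span hm hgen le_rfl
  rcases jac_principal_or_isLocalRing hm hmu hq1 hspan1 with ⟨j, hj, hjac⟩ | ⟨hloc, -⟩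
  · exact towerTop_eq_of_endRing_eq (endRing_jac_eq hj hjac)
  exfalso
  have hspan := map_maximalIdeal_eq_span hm hgen (tower_le_towerTop R Q 1)
  have hle := tower_le_towerTop R Q 1
  have hcancel {x y : towerTop R Q} (h : algebraMap R _ m * x = algebraMap R _ m * y) : x = y :=
    Subtype.ext (hmu.mul_left_cancel (congrArg (fun z : towerTop R Q => (z : Q)) h))
  have hmP {P : Ideal (towerTop R Q)} (hP : P.IsMaximal) : algebraMap R (towerTop R Q) m ∈ P :=
    (algebraMap_mem_iff_of_isIntegral hP).2 hm
  set ι := Subalgebra.inclusion hle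
  -- If `R₁` is local, its elements cannot tell the maximal ideals of `R_∞` apart; the contradiction
  -- will be an element of `R₁` that does.
  have hmem {P : Ideal (towerTop R Q)} (hP : P.IsMaximal) (c : tower R Q 1) :
      ι c ∈ P ↔ c ∈ maximalIdeal (tower R Q 1) := by
    constructor
    · intro h
      refine (mem_maximalIdeal c).2 fun hu => hP.ne_top ?_
      exact Ideal.eq_top_of_isUnit_mem _ h (hu.map ι)
    · intro h
      rw [← IsLocalRing.jacobson_eq_maximalIdeal (⊥ : Ideal (tower R Q 1)) bot_ne_top] at h
      have h2 := hq1.mul_mem_of_mem_jacobson h h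
      rw [hspan1] at h2
      obtain ⟨d, hd⟩ := Ideal.mem_span_singleton.1 h2
      have h3 : ι c * ι c = algebraMap R _ m * ι d := by
        rw [← map_mul, hd, map_mul, AlgHom.commutes]
      have h4 : ι c * ι c ∈ P := h3 ▸ P.mul_mem_right _ (hmP hP)
      exact (hP.isPrime.mem_or_mem h4).elim id id
  obtain ⟨e, e1, e2, e3⟩ := exists_congruences h₁ h₂ h₃ h₁₂ h₁₃ h₂₃ 1 0 0
  rw [sub_zero] at e2 e3
  obtain ⟨f, hf⟩ : ∃ f, e * e - e = algebraMap R _ m * f := by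
    have : e * e - e ∈ Ideal.jacobson (⊥ : Ideal (towerTop R Q)) := by
      refine Submodule.mem_sInf.2 fun P hP => ?_
      rcases hq.eq_or_eq_of_isMaximal h₁ h₂ h₃ hP.2 h₁₂ h₁₃ h₂₃ with rfl | rfl | rfl
      · have : e * e - e = e * (e - 1) := by ring
        rw [this]
        exact Ideal.mul_mem_left _ _ e1
      · exact sub_mem (Ideal.mul_mem_left _ _ e2) e2
      · exact sub_mem (Ideal.mul_mem_left _ _ e3) e3
    rw [hq.jacobson_eq_of_ne h₁ h₂ h₁₂, hspan] at this
    exact Ideal.mem_span_singleton.1 this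
  -- Dividing the quadratic relation of `e + ma` by `m` leaves a constant term `s' ∈ R₁` congruent
  -- to `f - a` at `P₂` and `P₃`. The choice of `a` makes this `0` and `-1` respectively.
  obtain ⟨a, -, a2, a3⟩ := exists_congruences h₁ h₂ h₃ h₁₂ h₁₃ h₂₃ 0 f (f + 1)
  set μ := algebraMap R (towerTop R Q) m
  obtain ⟨r, s, hrs⟩ := hq.exists_sq_eq (e + μ * a)
  have x2 : e + μ * a ∈ P₂ := P₂.add_mem e2 (P₂.mul_mem_right _ (hmP h₂))
  have x3 : e + μ * a ∈ P₃ := P₃.add_mem e3 (P₃.mul_mem_right _ (hmP h₃))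
  have hs : s ∈ maximalIdeal R := by
    rw [← algebraMap_mem_iff_of_isIntegral h₂]
    have : algebraMap R (towerTop R Q) s =
        (e + μ * a - algebraMap R _ r) * (e + μ * a) := by linear_combination -hrs
    rw [this]
    exact P₂.mul_mem_left _ x2
  have hr : r - 1 ∈ maximalIdeal R := by
    have hr' : r - 1 + s ∈ maximalIdeal R := by
      rw [← algebraMap_mem_iff_of_isIntegral h₁]
      have : algebraMap R (towerTop R Q) (r - 1 + s) =
          (e + μ * a + 1 - algebraMap R _ r) * (e - 1) +
            (e + μ * a + 1 - algebraMap R _ r) * a * μ := by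
        simp only [map_add, map_sub, map_one]
        linear_combination -hrs
      rw [this]
      exact P₁.add_mem (P₁.mul_mem_left _ e1) (P₁.mul_mem_left _ (hmP h₁))
    have := Ideal.sub_mem _ hr' hs
    rwa [add_sub_cancel_right] at this
  obtain ⟨r', hr', hrr⟩ := (hgen _).1 (mem_jac_bot_iff.2 ⟨_, hr, rfl⟩)
  obtain ⟨s', hs', hss⟩ := (hgen _).1 (mem_jac_bot_iff.2 ⟨_, hs, rfl⟩)
  have hrr' : algebraMap R (towerTop R Q) (r - 1) = μ * ι ⟨r', hr'⟩ := Subtype.ext hrr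
  have hss' : algebraMap R (towerTop R Q) s = μ * ι ⟨s', hs'⟩ := Subtype.ext hss
  have key : ι ⟨r', hr'⟩ * (e + μ * a) + ι ⟨s', hs'⟩ = f + a * (2 * e - 1) + μ * a ^ 2 := by
    apply hcancel
    rw [map_sub, map_one] at hrr'
    linear_combination hf - hrs - (e + μ * a) * hrr' - hss'
  have hs2 : ι ⟨s', hs'⟩ ∈ P₂ := by
    have : ι ⟨s', hs'⟩ = -(a - f) + 2 * a * e + a ^ 2 * μ - ι ⟨r', hr'⟩ * (e + μ * a) := by
      linear_combination key
    rw [this]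
    exact P₂.sub_mem (P₂.add_mem (P₂.add_mem (neg_mem a2) (P₂.mul_mem_left _ e2))
      (P₂.mul_mem_left _ (hmP h₂))) (P₂.mul_mem_left _ x2)
  have hs3 : ι ⟨s', hs'⟩ ∈ P₃ := (hmem h₃ _).2 ((hmem h₂ _).1 hs2)
  refine h₃.ne_top ((Ideal.eq_top_iff_one _).2 ?_)
  have : 1 = -(a - (f + 1)) + 2 * a * e + a ^ 2 * μ - ι ⟨r', hr'⟩ * (e + μ * a)
      - ι ⟨s', hs'⟩ := by
    linear_combination key
  rw [this]
  exact P₃.sub_mem (P₃.sub_mem (P₃.add_mem (P₃.add_mem (neg_mem a3) (P₃.mul_mem_left _ e3))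
      (P₃.mul_mem_left _ (hmP h₃))) (P₃.mul_mem_left _ x3)) hs3

/-- The witness is `R_∞ = R₁`, whose radical `mR₁` is `M`. For `r ∈ R`, either `r` or `r - 1` lies
in `M`, so `0` and `1` suffice from the prime subring. -/
theorem IsQuadraticRing.exists_isDedekind (hR : IsQuadraticRing R Q)
    (hdim : ringKrullDim R = 1) {P₁ P₂ P₃ : Ideal (towerTop R Q)} (h₁ : P₁.IsMaximal)
    (h₂ : P₂.IsMaximal) (h₃ : P₃.IsMaximal) (h₁₂ : P₁ ≠ P₂) (h₁₃ : P₁ ≠ P₃) (h₂₃ : P₂ ≠ P₃) :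
    ∃ S : Subalgebra R Q, IsDedekindWithZeroDivisors S ∧
      {N : Ideal S | N.IsMaximal}.ncard = 3 ∧
      (∀ N : Ideal S, N.IsMaximal → Nonempty (S ⧸ N ≃+* ZMod 2)) ∧
      Set.range (algebraMap R Q) =
        algebraMap R Q '' ((⊥ : Subring R) : Set R) + (jac S : Set Q) := by
  have hq := hR.isQuadraticExtension
  have := hq.isIntegral
  obtain ⟨m, hm, hmu, hgen⟩ := hR.exists_generator
  have hspan := map_maximalIdeal_eq_span hm hgen (tower_le_towerTop R Q 1)
  have htop := hR.towerTop_eq hm hmu hgen h₁ h₂ h₃ h₁₂ h₁₃ h₂₃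
  have hjac (q : Q) : q ∈ jac (towerTop R Q) ↔ ∃ r ∈ maximalIdeal R, algebraMap R Q r = q := by
    rw [← mem_jac_bot_iff, ← tower_zero, hgen, mem_jac,
      hq.jacobson_eq_of_ne h₁ h₂ h₁₂, hspan, ← htop]
    constructor
    · rintro ⟨x, hx, rfl⟩
      obtain ⟨c, rfl⟩ := Ideal.mem_span_singleton.1 hx
      exact ⟨c, c.2, rfl⟩
    · rintro ⟨c, hc, rfl⟩
      exact ⟨algebraMap R _ m * ⟨c, hc⟩, Ideal.mem_span_singleton.2 (dvd_mul_right _ _), rfl⟩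
  refine ⟨towerTop R Q, fun K hK => ?_, ?_, fun N hN => ?_, ?_⟩
  · obtain ⟨b, hb, rfl⟩ := hR.exists_eq_span hdim hK
    exact isUnit_coeIdeal_span_singleton hb
  · rw [hq.setOf_isMaximal_eq h₁ h₂ h₃ h₁₂ h₁₃ h₂₃]
    exact Set.ncard_eq_three.2 ⟨P₁, P₂, P₃, h₁₂, h₁₃, h₂₃, rfl⟩
  · refine nonempty_ringEquiv_zmod_two hN.ne_top ?_
    rcases hq.eq_or_eq_of_isMaximal h₁ h₂ h₃ hN h₁₂ h₁₃ h₂₃ with rfl | rfl | rfl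
    · exact hq.mem_or_sub_one_mem h₁ h₂ h₃ h₁₂ h₁₃ h₂₃
    · exact hq.mem_or_sub_one_mem h₂ h₁ h₃ h₁₂.symm h₂₃ h₁₃
    · exact hq.mem_or_sub_one_mem h₃ h₁ h₂ h₁₃.symm h₂₃.symm h₁₂
  · apply Set.Subset.antisymm
    · rintro _ ⟨r, rfl⟩
      rcases hq.mem_or_sub_one_mem h₁ h₂ h₃ h₁₂ h₁₃ h₂₃ (algebraMap R _ r) with h | h
      · rw [algebraMap_mem_iff_of_isIntegral h₁] at h
        exact ⟨0, ⟨0, zero_mem _, map_zero _⟩, _, (hjac _).2 ⟨r, h, rfl⟩, zero_add _⟩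
      · rw [← map_one (algebraMap R _), ← map_sub, algebraMap_mem_iff_of_isIntegral h₁] at h
        exact ⟨1, ⟨1, one_mem _, map_one _⟩, _, (hjac _).2 ⟨r - 1, h, rfl⟩, by simp⟩
    · rintro _ ⟨_, ⟨n, -, rfl⟩, q, hqj, rfl⟩
      obtain ⟨r, -, rfl⟩ := (hjac q).1 hqj
      exact ⟨n + r, map_add _ _ _⟩

end QuadraticTower

end OneDimStable

theorem corollary4p4 {R Q : Type*} [CommRing R] [CommRing Q] [Algebra R Q] [IsFractionRing R Q]
    [IsLocalRing R] (hdim : ringKrullDim R = 1)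
    (hreg : OneDimStable.IsRegularIdeal (IsLocalRing.maximalIdeal R)) :
    OneDimStable.IsQuadraticRing R Q ↔
      (OneDimStable.IsStableRing R ∨
        ∃ S : Subalgebra R Q,
          OneDimStable.IsDedekindWithZeroDivisors S ∧
          {N : Ideal S | N.IsMaximal}.ncard = 3 ∧
          (∀ N : Ideal S, N.IsMaximal → Nonempty (S ⧸ N ≃+* ZMod 2)) ∧
          Set.range (algebraMap R Q) =
            algebraMap R Q '' ((⊥ : Subring R) : Set R) + (OneDimStable.jac S : Set Q)) := by
  constructor
  · intro hR
    have : Nontrivial Q := (IsFractionRing.injective R Q).nontrivial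
    rcases OneDimStable.exists_three_or_forall_eq_or_eq (OneDimStable.towerTop R Q) with
      ⟨P₁, P₂, P₃, h₁, h₂, h₃, h₁₂, h₁₃, h₂₃⟩ | ⟨P₁, P₂, h₁, h₂, hmax⟩
    · exact .inr (hR.exists_isDedekind hdim h₁ h₂ h₃ h₁₂ h₁₃ h₂₃)
    · exact .inl (hR.isStableRing_of_forall_eq_or_eq hdim h₁ h₂ hmax)
  · rintro (hR | ⟨S, hS, hcard, hres, hrange⟩)
    · exact hR.isQuadraticRing hdim hreg
    · exact OneDimStable.isQuadraticRing_of_isDedekind hreg hS hcard hres hrange
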